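/- Let $\mathbb C^+=\{z:\operatorname{Im} z>0\}$. A (generalized) Herglotz function is a holomorphic map $m:\mathbb C^+\to\overline{\mathbb C^+}\subset\mathbb C_\infty$ (closure in the Riemann sphere; real constants and the constant $\infty$ are allowed). Let $m_+,m_-$ be Herglotz functions with $m_+\not\equiv -m_-$ (where $-\infty=\infty$), and let $H$ be the associated whole line canonical system. Its spectral properties are by definition those of the operator of multiplication by the variable in $L^2(\mathbb R,d\rho)$, where $\rho$ is the matrix valued measure from the Herglotz representation $M(z)=A+Bz+\int_{\mathbb R}\left(\frac1{t-z}-\frac t{1+t^2}\right)d\rho(t)$ of $$M(z)=\frac{1}{m_+(z)+m_-(z)}\begin{pmatrix}-1&\frac12(m_+(z)-m_-(z))\\ \frac12(m_+(z)-m_-(z))&m_+(z)m_-(z)\end{pmatrix}$$ (if exactly one of $m_\pm$ is $\equiv\infty$, the corresponding limit is taken). $H$ is called reflectionless on a Borel set $A\subseteq\mathbb R$ if $m_+(x)=-\overline{m_-(x)}$ for almost every $x\in A$, where $m_\pm(x)=\lim_{y\to0+}m_\pm(x+iy)$. **Theorem.** Let $T:\mathbb C\to SL(2,\mathbb C)$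 be entire with $T(x)\in SL(2,\mathbb R)$ for $x\in\mathbb R$, and suppose that $T\not\equiv 1$, $T\not\equiv -1$, and $\pm m_\pm(z)=T(z)(\pm m_\pm(z))$ for all $z\in\mathbb C^+$, where matrices act on $\mathbb C_\infty$ by linear fractional transformations. Let $$E=\{x\in\mathbb R: -2\le\operatorname{tr}T(x)\le 2\}.$$ Then $E$ is a union of disjoint closed intervals (possibly unbounded or consisting of single points) whose endpoints do not accumulate anywhere, $H$ is reflectionless on $E$, and the spectrum of $H$ is contained in $E$. Moreover, $H$ has no singular continuous spectrum, the absolutely continuous spectrum is essentially supported by $E$ and has multiplicity $2$ there (that is, the density $d\rho_{ac}/dx$ has rank $2$ for almost every $x\in E$ and vanishes for almost every $x\notin E$), and every eigenvalue of $H$ is an isolated point of $E$. -/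

import Mathlib

open Filter Topology MeasureTheory

noncomputable section

namespace TodaMap

/-- The group `SL` of entire functions `T : ℂ → SL(2, ℂ)` with `T(x) ∈ SL(2, ℝ)` for real `x`. -/
def IsEntireSL (T : ℂ → Matrix.SpecialLinearGroup (Fin 2) ℂ) : Prop :=
  (∀ i j, Differentiable ℂ fun z => (T z).1 i j) ∧ ∀ (x : ℝ) (i j), ((T x).1 i j).im = 0

/-- (Generalized) Herglotz functions: holomorphic maps from the open upper half plane `ℂ⁺` to the
Riemann sphere, with values in the closure `{Im w ≥ 0} ∪ {∞}` of `ℂ⁺`. By the open mapping theorem,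
such a map is either identically `∞` or it never takes the value `∞`. Real constants are allowed.
Only the values of `m` on `ℂ⁺` are relevant. -/
def IsHerglotz (m : ℂ → OnePoint ℂ) : Prop :=
  (∀ z : ℂ, 0 < z.im → m z = OnePoint.infty) ∨
  ∃ f : ℂ → ℂ, DifferentiableOn ℂ f {z | 0 < z.im} ∧
    ∀ z : ℂ, 0 < z.im → 0 ≤ (f z).im ∧ m z = OnePoint.some (f z)

/-- The map `w ↦ -w` on the Riemann sphere (`-∞ = ∞`). -/
def neg (w : OnePoint ℂ) : OnePoint ℂ := w.map fun v => -v

/-- The map `w ↦ -conj w` on the Riemann sphere. -/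
def negConj (w : OnePoint ℂ) : OnePoint ℂ := w.map fun v => -(starRingEnd ℂ v)

/-- `w` is the boundary value `m(x) = lim_{y → 0+} m(x + iy)`, a limit on the Riemann sphere. -/
def HasBoundaryValue (m : ℂ → OnePoint ℂ) (x : ℝ) (w : OnePoint ℂ) : Prop :=
  Tendsto (fun y : ℝ => m (x + y * Complex.I)) (𝓝[>] 0) (𝓝 w)

/-- The pair `m₊, m₋` is reflectionless on `A`: `m₊(x) = -conj (m₋(x))` for a.e. `x ∈ A`. -/
def Reflectionless (mp mm : ℂ → OnePoint ℂ) (A : Set ℝ) : Prop :=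
  ∀ᵐ x : ℝ, x ∈ A → ∃ w, HasBoundaryValue mm x w ∧ HasBoundaryValue mp x (negConj w)

/-- The matrix
`M = (m₊ + m₋)⁻¹ [[-1, (m₊ - m₋)/2], [(m₊ - m₋)/2, m₊ m₋]]`
built from the values `m₊, m₋`; if exactly one of these is `∞`, then `M` is the corresponding limit.
(The matrix is undefined, and the value below is irrelevant, if `m₊ = -m₋`.) -/
def matrixM : OnePoint ℂ → OnePoint ℂ → Matrix (Fin 2) (Fin 2) ℂ
  | OnePoint.some p, OnePoint.some q =>
      (p + q)⁻¹ • !![-1, (p - q) / 2; (p - q) / 2, p * q]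
  | OnePoint.infty, OnePoint.some q => !![0, 1 / 2; 1 / 2, q]
  | OnePoint.some p, OnePoint.infty => !![0, -1 / 2; -1 / 2, p]
  | OnePoint.infty, OnePoint.infty => 0

/-- A locally finite Borel measure `ρ` on `ℝ` whose values are positive semidefinite real `2 × 2`
matrices, written as `dρ = W dμ` with `μ = ρ₀₀ + ρ₁₁` its trace and `W` its matrix density. -/
structure MatrixMeasure where
  /-- the trace measure `μ` -/
  μ : Measure ℝ
  /-- the density `W = dρ/dμ` -/
  W : ℝ → Matrix (Fin 2) (Fin 2) ℝ
  locallyFinite : IsLocallyFiniteMeasure μ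
  measurable_W : ∀ i j, Measurable fun t => W t i j
  posSemidef_W : ∀ t, (W t).PosSemidef
  trace_W : ∀ t, (W t).trace = 1

/-- `ρ` is the matrix valued measure from the Herglotz representation
`M(z) = A + B z + ∫ (1/(t - z) - t/(1 + t²)) dρ(t)`, `Im z > 0`,
of the function `M` associated with the pair `m₊, m₋`. -/
def IsSpectralMeasure (mp mm : ℂ → OnePoint ℂ) (ρ : MatrixMeasure) : Prop :=
  Integrable (fun t : ℝ => 1 / (1 + t ^ 2)) ρ.μ ∧
  ∃ A B : Matrix (Fin 2) (Fin 2) ℝ, A.IsSymm ∧ B.PosSemidef ∧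
    ∀ z : ℂ, 0 < z.im → ∀ i j,
      matrixM (mp z) (mm z) i j =
        A i j + B i j * z + ∫ t : ℝ, (1 / (t - z) - t / (1 + t ^ 2)) * (ρ.W t i j : ℂ) ∂ρ.μ

namespace MatrixMeasure

variable (ρ : MatrixMeasure)

/-- For `f : ℝ → ℂ²`, the measure `dρ_f = f* dρ f = f* W f dμ`. -/
def spec (f : ℝ → Fin 2 → ℂ) : Measure ℝ :=
  ρ.μ.withDensity fun t =>
    ENNReal.ofReal (star (f t) ⬝ᵥ ((ρ.W t).map Complex.ofReal).mulVec (f t)).re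

/-- `f` represents an element of the Hilbert space `L²(ℝ, dρ)`: `‖f‖² = ∫ f* dρ f < ∞`. -/
def MemL2 (f : ℝ → Fin 2 → ℂ) : Prop := Measurable f ∧ ρ.spec f Set.univ < ⊤

/-- `f` represents the zero element of `L²(ℝ, dρ)`: `∫ f* dρ f = 0`. -/
def IsNull (f : ℝ → Fin 2 → ℂ) : Prop := ρ.spec f Set.univ = 0

/-- The function `(t - z) f(t)`. -/
def mulSub (z : ℂ) (f : ℝ → Fin 2 → ℂ) : ℝ → Fin 2 → ℂ := fun t => ((t : ℂ) - z) • f t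

/-- The spectrum of the self-adjoint operator `X` of multiplication by the variable in `L²(ℝ, dρ)`,
with domain `{f ∈ L² : t f(t) ∈ L²}`: those `z` for which `X - z`, as a map from the domain
to `L²(ℝ, dρ)`, is not bijective. (Since `X` is closed, a bijective `X - z` has bounded inverse.) -/
def spectrum : Set ℂ :=
  {z | ¬ ((∀ f, ρ.MemL2 f → ρ.MemL2 (mulSub 0 f) → ρ.IsNull (mulSub z f) → ρ.IsNull f) ∧
    ∀ g, ρ.MemL2 g →
      ∃ f, ρ.MemL2 f ∧ ρ.MemL2 (mulSub 0 f) ∧ ρ.IsNull (mulSub z f - g))}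

/-- `z` is an eigenvalue of the operator of multiplication by the variable in `L²(ℝ, dρ)`. -/
def IsEigenvalue (z : ℂ) : Prop :=
  ∃ f, ρ.MemL2 f ∧ ρ.MemL2 (mulSub 0 f) ∧ ¬ ρ.IsNull f ∧ ρ.IsNull (mulSub z f)

/-- The operator of multiplication by the variable in `L²(ℝ, dρ)` has no singular continuous
spectrum: an element whose spectral measure `ρ_f` is singular continuous must be zero. -/
def NoSingularContinuousSpectrum : Prop :=
  ∀ f, ρ.MemL2 f → (ρ.spec f).MutuallySingular volume → (∀ x, ρ.spec f {x} = 0) → ρ.IsNull f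

/-- The density `dρ_ac/dx` of the absolutely continuous part of `ρ`. -/
def acDensity (x : ℝ) : Matrix (Fin 2) (Fin 2) ℝ := (ρ.μ.rnDeriv volume x).toReal • ρ.W x

/-- The absolutely continuous spectrum is essentially supported by `A` and has multiplicity `n`
there. The local multiplicity at `x` is the rank of the density `dρ_ac/dx`. -/
def ACSpectrumOn (A : Set ℝ) (n : ℕ) : Prop :=
  ∀ᵐ x : ℝ, (x ∈ A → (ρ.acDensity x).rank = n) ∧ (x ∉ A → ρ.acDensity x = 0)

end MatrixMeasure

/-- `E = {x ∈ ℝ : -2 ≤ tr T(x) ≤ 2}` (the trace is real for real `x`). -/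
def bandSet (T : ℂ → Matrix.SpecialLinearGroup (Fin 2) ℂ) : Set ℝ :=
  {x | -2 ≤ ((T x).1.trace).re ∧ ((T x).1.trace).re ≤ 2}

/-- `E` is a union of disjoint closed intervals (possibly unbounded or consisting of single points),
whose endpoints do not accumulate anywhere. The endpoints of a closed interval are its boundary
points. -/
def IsUnionOfIntervals (E : Set ℝ) : Prop :=
  ∃ S : Set (Set ℝ), (∀ I ∈ S, I.Nonempty ∧ IsClosed I ∧ I.OrdConnected) ∧
    S.PairwiseDisjoint id ∧ ⋃₀ S = E ∧ ∀ x : ℝ, ¬ AccPt x (𝓟 (⋃ I ∈ S, frontier I))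

/-- `x` is an isolated point of `E`. -/
def IsIsolatedPoint (E : Set ℝ) (x : ℝ) : Prop := x ∈ E ∧ ¬ AccPt x (𝓟 E)

end TodaMap

end

/-! Write `T = (a b; c d)`. The functions `m₊` and `-m₋` are the fixed points of `T(z)`, that is,
the roots of `c w² + (d - a) w - b`, whose discriminant is `D = (tr T)² - 4` because `det T = 1`.
Hence `s = c (m₊ + m₋)` is a holomorphic square root of `D` on the upper half plane, and Vieta's
formulas give `M = N / s` with `N` entire, real on the real line, and `det N = -D/4`
(`exists_sqrt_disc`). If `D ≡ 0`, then `s = 0`, so `N = 0` and `T ≡ ±1` (`eq_one_or_neg_one`).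
Otherwise the real zeros of `D` are discrete, and since `E = {D ≤ 0}` they contain all its boundary
points.

Away from these zeros `s` extends continuously to the real line (`exists_tendsto_sqrt`): it is real
where `D > 0` and purely imaginary where `D < 0`. In the second case conjugation interchanges the
two roots, so the pair is reflectionless on `E`. Stieltjes inversion
(`restrict_eq_withDensity_boundaryValue`) gives `dρ = π⁻¹ Im M dx` off the zeros. This vanishes
where `D > 0`, and where `D < 0` it is a nonzero multiple of the invertible matrix `N`, so it has
rank 2. What remains lives on a countable set, so there is no singular continuous part.

A point mass `p` of a diagonal entry at `x` satisfies `p² = lim (z - x)² N² / D`. The right side is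
meromorphic, so the limit may also be taken along real points of `E`, where the expression is `≤ 0`.
Thus `p = 0` unless `x` is isolated in `E` (`measure_singleton_eq_zero_of_accPt`). -/

namespace TodaMap

/-! ### Poisson integrals and Stieltjes inversion -/

/-- The Poisson kernel `y / ((t - x)² + y²)` of the upper half plane (up to the factor `π`). -/
noncomputable def poissonKernel (y x t : ℝ) : ℝ := y / ((t - x) ^ 2 + y ^ 2)

theorem poissonKernel_nonneg {y : ℝ} (hy : 0 < y) (x t : ℝ) : 0 ≤ poissonKernel y x t := by
  unfold poissonKernel; positivity

theorem continuous_poissonKernel {y : ℝ} (hy : 0 < y) :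
    Continuous fun p : ℝ × ℝ => poissonKernel y p.1 p.2 := by
  unfold poissonKernel
  exact continuous_const.div (by fun_prop) fun p => by positivity

theorem integral_poissonKernel {y : ℝ} (hy : 0 < y) (a b t : ℝ) :
    ∫ x in a..b, poissonKernel y x t = Real.arctan ((b - t) / y) - Real.arctan ((a - t) / y) := by
  rw [intervalIntegral.integral_eq_sub_of_hasDerivAt (f := fun x => Real.arctan ((x - t) / y))]
  · intro x _
    have h := (((hasDerivAt_id x).sub_const t).div_const y).arctan
    refine h.congr_deriv ?_
    rw [poissonKernel]
    have : (t - x) ^ 2 + y ^ 2 ≠ 0 := by positivity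
    have h2 : 1 + ((id x - t) / y) ^ 2 ≠ 0 := by positivity
    simp only [id] at *
    field_simp
    ring
  · exact ((continuous_poissonKernel hy).comp (by fun_prop :
      Continuous fun x : ℝ => (x, t))).intervalIntegrable _ _

/-- From `t² ≤ 2 (t - x)² + 2 x²`. It compares the kernel with the weight `1 / (1 + t²)` uniformly
for `x` in a bounded set. -/
theorem poissonKernel_mul_le {y x R : ℝ} (hy : 0 < y) (hx : |x| ≤ R) (t : ℝ) :
    poissonKernel y x t * (1 + t ^ 2) ≤ 2 * y + (1 + 2 * R ^ 2) * poissonKernel y x t := by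
  have hx2 : x ^ 2 ≤ R ^ 2 := sq_le_sq' (by linarith [abs_le.1 hx]) (abs_le.1 hx).2
  have hD : 0 < (t - x) ^ 2 + y ^ 2 := by positivity
  unfold poissonKernel
  have key : y * (1 + t ^ 2) ≤ 2 * y * ((t - x) ^ 2 + y ^ 2) + (1 + 2 * R ^ 2) * y := by
    have : 1 + t ^ 2 ≤ 2 * ((t - x) ^ 2 + y ^ 2) + (1 + 2 * R ^ 2) := by
      nlinarith [sq_nonneg (t - 2 * x), sq_nonneg y]
    nlinarith
  calc y / ((t - x) ^ 2 + y ^ 2) * (1 + t ^ 2)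
      = y * (1 + t ^ 2) / ((t - x) ^ 2 + y ^ 2) := by ring
    _ ≤ (2 * y * ((t - x) ^ 2 + y ^ 2) + (1 + 2 * R ^ 2) * y) / ((t - x) ^ 2 + y ^ 2) := by gcongr
    _ = _ := by field_simp

theorem poissonKernel_le_inv {y : ℝ} (hy : 0 < y) (x t : ℝ) : poissonKernel y x t ≤ y⁻¹ := by
  unfold poissonKernel
  rw [div_le_iff₀ (by positivity)]
  field_simp
  nlinarith [sq_nonneg (t - x)]

/-- The kernel itself grows like `1 / y`, but its integral over `x` never exceeds `π`. This yields a
dominating function valid for all small `y`. -/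
theorem integral_poissonKernel_le {y a b R : ℝ} (hy : 0 < y) (hab : a ≤ b)
    (hR : ∀ x ∈ Set.Icc a b, |x| ≤ R) (t : ℝ) :
    ∫ x in a..b, poissonKernel y x t ≤
      (2 * y * (b - a) + (1 + 2 * R ^ 2) * Real.pi) * (1 / (1 + t ^ 2)) := by
  have hc : Continuous fun x : ℝ => poissonKernel y x t :=
    (continuous_poissonKernel hy).comp (by fun_prop : Continuous fun x : ℝ => (x, t))
  have h1 : ∫ x in a..b, poissonKernel y x t * (1 + t ^ 2) ≤
      ∫ x in a..b, (2 * y + (1 + 2 * R ^ 2) * poissonKernel y x t) :=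
    intervalIntegral.integral_mono_on hab (by apply Continuous.intervalIntegrable; fun_prop)
      (by apply Continuous.intervalIntegrable; fun_prop)
      fun x hx => poissonKernel_mul_le hy (hR x hx) t
  rw [intervalIntegral.integral_mul_const, intervalIntegral.integral_add (by simp)
    (by apply Continuous.intervalIntegrable; fun_prop)] at h1
  have h2 : ∫ x in a..b, poissonKernel y x t ≤ Real.pi := by
    rw [integral_poissonKernel hy]
    linarith [Real.arctan_lt_pi_div_two ((b - t) / y), Real.neg_pi_div_two_lt_arctan ((a - t) / y)]
  rw [mul_one_div, le_div_iff₀ (by positivity)]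
  refine h1.trans ?_
  rw [intervalIntegral.integral_const, intervalIntegral.integral_const_mul, smul_eq_mul,
    mul_comm (b - a)]
  gcongr

/-- The convention `Real.sign 0 = 0` is the right one here: it is why an atom at an endpoint of an
interval is counted with weight one half. -/
theorem tendsto_arctan_div (c : ℝ) :
    Tendsto (fun y : ℝ => Real.arctan (c / y)) (𝓝[>] 0) (𝓝 (Real.pi / 2 * Real.sign c)) := by
  rcases lt_trichotomy c 0 with h | rfl | h
  · rw [Real.sign_of_neg h, mul_neg_one]
    refine (Real.tendsto_arctan_atBot.mono_right nhdsWithin_le_nhds).comp ?_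
    exact (tendsto_inv_nhdsGT_zero.const_mul_atTop_of_neg h).congr fun y => (div_eq_mul_inv c y).symm
  · simp
  · rw [Real.sign_of_pos h, mul_one]
    refine (Real.tendsto_arctan_atTop.mono_right nhdsWithin_le_nhds).comp ?_
    exact (tendsto_inv_nhdsGT_zero.const_mul_atTop h).congr fun y => (div_eq_mul_inv c y).symm

/-- The hypothesis for Fubini. Here `y` is fixed, so the crude bound `y⁻¹` on the kernel is enough.
-/
theorem integrable_poissonKernel_prod {ν : Measure ℝ} [SFinite ν]
    (hν : Integrable (fun t : ℝ => 1 / (1 + t ^ 2)) ν) {y : ℝ} (hy : 0 < y) (a b : ℝ) :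
    Integrable (fun p : ℝ × ℝ => poissonKernel y p.1 p.2)
      ((volume.restrict (Set.uIoc a b)).prod ν) := by
  set R : ℝ := max |a| |b|
  have : IsFiniteMeasure (volume.restrict (Set.uIoc a b)) := by
    rw [Set.uIoc]; infer_instance
  have hbd : Integrable (fun p : ℝ × ℝ => (2 * y + (1 + 2 * R ^ 2) * y⁻¹) * (1 / (1 + p.2 ^ 2)))
      ((volume.restrict (Set.uIoc a b)).prod ν) :=
    (hν.comp_snd _).const_mul _
  have hfin : ∀ᵐ p ∂((volume.restrict (Set.uIoc a b)).prod ν), p.1 ∈ Set.uIoc a b :=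
    Measure.quasiMeasurePreserving_fst.ae (ae_restrict_mem measurableSet_uIoc)
  refine hbd.mono' (continuous_poissonKernel hy).aestronglyMeasurable ?_
  filter_upwards [hfin] with p hp
  have hR : |p.1| ≤ R := by
    rcases Set.mem_uIoc.1 hp with h | h
    · exact abs_le_max_abs_abs h.1.le h.2
    · rw [show R = max |b| |a| from max_comm _ _]; exact abs_le_max_abs_abs h.1.le h.2
  rw [Real.norm_of_nonneg (poissonKernel_nonneg hy _ _), mul_one_div, le_div_iff₀ (by positivity)]
  refine (poissonKernel_mul_le hy hR _).trans ?_
  gcongr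
  exact poissonKernel_le_inv hy _ _

/-- A function which has boundary values along a compact subset of the real line is bounded near
this set. -/
theorem exists_bound_of_tendsto {u : ℂ → ℝ} {w : ℝ → ℝ} {K : Set ℝ} (hK : IsCompact K)
    (hlim : ∀ x ∈ K, Tendsto u (𝓝[{z | 0 < z.im}] (x : ℂ)) (𝓝 (w x))) :
    ∃ C, ∀ᶠ y : ℝ in 𝓝[>] 0, ∀ x ∈ K, |u (x + y * Complex.I)| ≤ C := by
  -- Boundedness near a set passes to subsets and finite unions, so by compactness a local bound at
  -- each point suffices.
  refine hK.induction_on (p := fun S => ∃ C, ∀ᶠ y : ℝ in 𝓝[>] 0, ∀ x ∈ S,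
    |u (x + y * Complex.I)| ≤ C) ⟨0, by simp⟩ ?_ ?_ ?_
  · rintro s t hst ⟨C, hC⟩
    exact ⟨C, hC.mono fun y hy x hx => hy x (hst hx)⟩
  · rintro s t ⟨C, hC⟩ ⟨D, hD⟩
    refine ⟨max C D, ?_⟩
    filter_upwards [hC, hD] with y h1 h2 x hx
    rcases hx with hx | hx
    · exact (h1 x hx).trans (le_max_left _ _)
    · exact (h2 x hx).trans (le_max_right _ _)
  · intro x hx
    have h := (hlim x hx).abs.eventually_le_const (lt_add_one |w x|)
    rw [eventually_nhdsWithin_iff, Metric.eventually_nhds_iff] at h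
    obtain ⟨ε, hε, h⟩ := h
    refine ⟨Metric.ball x (ε / 2), mem_nhdsWithin_of_mem_nhds (Metric.ball_mem_nhds _ (by positivity)),
      |w x| + 1, ?_⟩
    filter_upwards [Ioo_mem_nhdsGT (half_pos hε)] with y hy x' hx'
    refine h ?_ (by simpa using hy.1)
    rw [Metric.mem_ball, Real.dist_eq] at hx'
    rw [dist_eq_norm]
    calc ‖(x' : ℂ) + y * Complex.I - x‖ = ‖((x' - x : ℝ) : ℂ) + y * Complex.I‖ := by
          push_cast; ring_nf
      _ ≤ ‖((x' - x : ℝ) : ℂ)‖ + ‖(y : ℂ) * Complex.I‖ := norm_add_le _ _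
      _ = |x' - x| + |y| := by
          rw [Complex.norm_real, norm_mul, Complex.norm_real, Complex.norm_I, mul_one]; rfl
      _ < ε := by rw [abs_of_pos hy.1]; linarith [hy.2]

theorem tendsto_vertical (x : ℝ) :
    Tendsto (fun y : ℝ => (x + y * Complex.I : ℂ)) (𝓝[>] 0) (𝓝[{z | 0 < z.im}] (x : ℂ)) := by
  refine tendsto_nhdsWithin_iff.2 ⟨?_, ?_⟩
  · have : Tendsto (fun y : ℝ => (x + y * Complex.I : ℂ)) (𝓝 0) (𝓝 (x + (0 : ℝ) * Complex.I)) :=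
      Continuous.tendsto (by fun_prop) 0
    simp only [Complex.ofReal_zero, zero_mul, add_zero] at this
    exact this.mono_left nhdsWithin_le_nhds
  · filter_upwards [self_mem_nhdsWithin] with y hy
    simpa using hy

/-- The limit is taken within the whole half plane, not only vertically; this is what makes the
boundary function continuous. -/
theorem continuousOn_boundaryValue {u : ℂ → ℝ} {w : ℝ → ℝ} {K : Set ℝ}
    (hlim : ∀ x ∈ K, Tendsto u (𝓝[{z | 0 < z.im}] (x : ℂ)) (𝓝 (w x))) : ContinuousOn w K := by
  have hcl : ∀ x : ℝ, (x : ℂ) ∈ closure {z : ℂ | 0 < z.im} := fun x =>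
    mem_closure_of_tendsto ((tendsto_vertical x).mono_right nhdsWithin_le_nhds)
      (by filter_upwards [self_mem_nhdsWithin] with y hy; simpa using hy)
  have h := continuousOn_extendFrom (f := u) (A := {z : ℂ | 0 < z.im})
    (B := Complex.ofReal '' K) (by rintro _ ⟨x, -, rfl⟩; exact hcl x)
    (by rintro _ ⟨x, hx, rfl⟩; exact ⟨_, hlim x hx⟩)
  have h2 := h.comp Complex.continuous_ofReal.continuousOn (Set.mapsTo_image _ _)
  exact h2.congr fun x hx => (extendFrom_eq (hcl x) (hlim x hx)).symm

/-- Integrated form of the Stieltjes inversion formula. -/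
theorem integral_boundaryValue {ν : Measure ℝ} [IsLocallyFiniteMeasure ν]
    (hν : Integrable (fun t : ℝ => 1 / (1 + t ^ 2)) ν) {u : ℂ → ℝ} {β : ℝ}
    (hu : ∀ z : ℂ, 0 < z.im → u z = β * z.im + ∫ t, poissonKernel z.im z.re t ∂ν)
    {a b : ℝ} (hab : a ≤ b) {w : ℝ → ℝ}
    (hlim : ∀ x ∈ Set.Icc a b, Tendsto u (𝓝[{z | 0 < z.im}] (x : ℂ)) (𝓝 (w x))) :
    ∫ x in a..b, w x =
      ∫ t, (Real.pi / 2 * Real.sign (b - t) - Real.pi / 2 * Real.sign (a - t)) ∂ν := by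
  have hu' : ∀ y : ℝ, 0 < y → ∀ x : ℝ,
      u (x + y * Complex.I) = β * y + ∫ t, poissonKernel y x t ∂ν := fun y hy x => by
    simpa using hu (x + y * Complex.I) (by simpa using hy)
  have hint : ∀ y : ℝ, 0 < y →
      IntervalIntegrable (fun x => ∫ t, poissonKernel y x t ∂ν) volume a b := fun y hy => by
    rw [intervalIntegrable_iff]
    exact (integrable_poissonKernel_prod hν hy a b).integral_prod_left
  -- Fubini, after which the integral of the kernel over `x` is an explicit difference of
  -- arctangents.
  have hswap : ∀ y : ℝ, 0 < y → ∫ x in a..b, u (x + y * Complex.I) =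
      β * y * (b - a) +
        ∫ t, (Real.arctan ((b - t) / y) - Real.arctan ((a - t) / y)) ∂ν := fun y hy => by
    simp_rw [hu' y hy]
    rw [intervalIntegral.integral_add (by simp) (hint y hy), intervalIntegral.integral_const,
      smul_eq_mul, mul_comm (b - a)]
    congr 1
    have hi := integrable_poissonKernel_prod hν hy a b
    rw [Set.uIoc_of_le hab] at hi
    rw [intervalIntegral.integral_of_le hab, integral_integral_swap hi]
    refine integral_congr_ae (Eventually.of_forall fun t => ?_)
    simp only
    rw [← intervalIntegral.integral_of_le hab, integral_poissonKernel hy]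
  have hL : Tendsto (fun y : ℝ => ∫ x in a..b, u (x + y * Complex.I)) (𝓝[>] 0)
      (𝓝 (∫ x in a..b, w x)) := by
    obtain ⟨C, hC⟩ := exists_bound_of_tendsto isCompact_Icc hlim
    refine intervalIntegral.tendsto_integral_filter_of_dominated_convergence (fun _ => C) ?_ ?_
      (by simp) ?_
    · filter_upwards [self_mem_nhdsWithin] with y hy
      simp_rw [hu' y hy]
      exact aestronglyMeasurable_const.add (intervalIntegrable_iff.1 (hint y hy)).1
    · filter_upwards [hC] with y hy
      refine Eventually.of_forall fun x hx => hy x ?_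
      rw [Set.uIoc_of_le hab] at hx
      exact Set.Ioc_subset_Icc_self hx
    · refine Eventually.of_forall fun x hx => ?_
      rw [Set.uIoc_of_le hab] at hx
      exact (hlim x (Set.Ioc_subset_Icc_self hx)).comp (tendsto_vertical x)
  have hR : Tendsto (fun y : ℝ => β * y * (b - a) +
      ∫ t, (Real.arctan ((b - t) / y) - Real.arctan ((a - t) / y)) ∂ν) (𝓝[>] 0)
      (𝓝 (β * 0 * (b - a) +
        ∫ t, (Real.pi / 2 * Real.sign (b - t) - Real.pi / 2 * Real.sign (a - t)) ∂ν)) := by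
    refine Tendsto.add ?_ ?_
    · exact (Continuous.tendsto (by fun_prop) 0).mono_left nhdsWithin_le_nhds
    · set R : ℝ := max |a| |b|
      refine tendsto_integral_filter_of_dominated_convergence
        (fun t => (2 * 1 * (b - a) + (1 + 2 * R ^ 2) * Real.pi) * (1 / (1 + t ^ 2))) ?_ ?_
        (hν.const_mul _) ?_
      · filter_upwards [self_mem_nhdsWithin] with y hy
        exact Continuous.aestronglyMeasurable (by fun_prop)
      · filter_upwards [Ioo_mem_nhdsGT one_pos] with y hy
        refine Eventually.of_forall fun t => ?_
        rw [← integral_poissonKernel hy.1, Real.norm_of_nonneg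
          (intervalIntegral.integral_nonneg hab fun x _ => poissonKernel_nonneg hy.1 _ _)]
        refine (integral_poissonKernel_le hy.1 hab
          (fun x hx => abs_le_max_abs_abs hx.1 hx.2) t).trans ?_
        have h1 : 2 * y * (b - a) ≤ 2 * 1 * (b - a) :=
          mul_le_mul_of_nonneg_right (by linarith [hy.2]) (by linarith)
        gcongr
      · exact Eventually.of_forall fun t =>
          (tendsto_arctan_div (b - t)).sub (tendsto_arctan_div (a - t))
  simp only [mul_zero, zero_mul, zero_add] at hR
  refine tendsto_nhds_unique hL (hR.congr' ?_)
  filter_upwards [self_mem_nhdsWithin] with y hy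
  exact (hswap y hy).symm

/-- Averaging the closed and the open interval encodes the half weight of the two endpoints. -/
theorem pi_div_two_mul_sign_sub {a b : ℝ} (hab : a < b) (t : ℝ) :
    Real.pi / 2 * Real.sign (b - t) - Real.pi / 2 * Real.sign (a - t) =
      Real.pi / 2 * ((Set.Icc a b).indicator 1 t + (Set.Ioo a b).indicator 1 t) := by
  rcases lt_trichotomy a t with h | rfl | h
  · rw [Real.sign_of_neg (sub_neg.2 h)]
    rcases lt_trichotomy b t with h' | rfl | h'
    · rw [Real.sign_of_neg (sub_neg.2 h'), Set.indicator_of_notMem (by simp [h']),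
        Set.indicator_of_notMem (by simp [h'.le])]
      ring
    · rw [sub_self, Real.sign_zero, Set.indicator_of_mem (by simp [h.le]),
        Set.indicator_of_notMem (by simp)]
      simp
    · rw [Real.sign_of_pos (sub_pos.2 h'), Set.indicator_of_mem (Set.mem_Icc.2 ⟨h.le, h'.le⟩),
        Set.indicator_of_mem (Set.mem_Ioo.2 ⟨h, h'⟩)]
      simp only [Pi.one_apply]; ring
  · rw [sub_self, Real.sign_zero, Real.sign_of_pos (sub_pos.2 hab),
      Set.indicator_of_mem (by simp [hab.le]), Set.indicator_of_notMem (by simp)]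
    simp
  · rw [Real.sign_of_pos (sub_pos.2 h), Real.sign_of_pos (sub_pos.2 (h.trans hab)),
      Set.indicator_of_notMem (by simp [h]), Set.indicator_of_notMem (by simp [h.le])]
    ring

section Inversion

variable {ν : Measure ℝ} [IsLocallyFiniteMeasure ν] {u : ℂ → ℝ} {β : ℝ} {w : ℝ → ℝ}

theorem integral_boundaryValue_eq_measureReal
    (hν : Integrable (fun t : ℝ => 1 / (1 + t ^ 2)) ν)
    (hu : ∀ z : ℂ, 0 < z.im → u z = β * z.im + ∫ t, poissonKernel z.im z.re t ∂ν)
    {a b : ℝ} (hab : a < b)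
    (hlim : ∀ x ∈ Set.Icc a b, Tendsto u (𝓝[{z | 0 < z.im}] (x : ℂ)) (𝓝 (w x))) :
    ∫ x in a..b, w x = Real.pi / 2 * (ν.real (Set.Icc a b) + ν.real (Set.Ioo a b)) := by
  rw [integral_boundaryValue hν hu hab.le hlim]
  simp_rw [pi_div_two_mul_sign_sub hab]
  rw [integral_const_mul, integral_add, integral_indicator_one measurableSet_Icc,
    integral_indicator_one measurableSet_Ioo]
  · exact (integrable_indicator_iff measurableSet_Icc).2
      (integrableOn_const (measure_Icc_lt_top.ne) (by simp))
  · exact (integrable_indicator_iff measurableSet_Ioo).2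
      (integrableOn_const (measure_Ioo_lt_top.ne) (by simp))

/-- An atom at `x` would contribute at least `π/2` times its mass to the integral of `w` over every
`[x, b]`, but this integral is `O(b - x)` since `w` is bounded near `x`. -/
theorem measure_singleton_eq_zero_of_tendsto
    (hν : Integrable (fun t : ℝ => 1 / (1 + t ^ 2)) ν)
    (hu : ∀ z : ℂ, 0 < z.im → u z = β * z.im + ∫ t, poissonKernel z.im z.re t ∂ν)
    {U : Set ℝ} (hU : IsOpen U)
    (hlim : ∀ x ∈ U, Tendsto u (𝓝[{z | 0 < z.im}] (x : ℂ)) (𝓝 (w x))) {x : ℝ} (hx : x ∈ U) :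
    ν {x} = 0 := by
  obtain ⟨c, hxc, hc⟩ : ∃ c, x < c ∧ Set.Icc x c ⊆ U := by
    obtain ⟨ε, hε, h⟩ := Metric.isOpen_iff.1 hU x hx
    refine ⟨x + ε / 2, by linarith, fun y hy => h ?_⟩
    rw [Metric.mem_ball, Real.dist_eq, abs_of_nonneg (by linarith [hy.1])]
    linarith [hy.2]
  have hcont := continuousOn_boundaryValue fun y hy => hlim y (hc hy)
  obtain ⟨C, hC⟩ := isCompact_Icc.exists_bound_of_continuousOn hcont
  have hle : ∀ b ∈ Set.Ioo x c, Real.pi / 2 * ν.real {x} ≤ C * (b - x) := fun b hb => by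
    have h1 := integral_boundaryValue_eq_measureReal hν hu hb.1
      fun y hy => hlim y (hc ⟨hy.1, hy.2.trans hb.2.le⟩)
    have h2 : ‖∫ y in x..b, w y‖ ≤ C * |b - x| :=
      intervalIntegral.norm_integral_le_of_norm_le_const fun y hy => by
        rw [Set.uIoc_of_le hb.1.le] at hy
        exact hC y ⟨hy.1.le, hy.2.trans hb.2.le⟩
    rw [Real.norm_eq_abs, abs_of_pos (sub_pos.2 hb.1)] at h2
    refine le_trans ?_ ((le_abs_self _).trans h2)
    rw [h1]
    have h3 : ν.real {x} ≤ ν.real (Set.Icc x b) :=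
      measureReal_mono (Set.singleton_subset_iff.2 (Set.left_mem_Icc.2 hb.1.le))
        measure_Icc_lt_top.ne
    have h4 : 0 ≤ ν.real (Set.Ioo x b) := measureReal_nonneg
    gcongr
    linarith
  have hlim0 : Tendsto (fun b : ℝ => C * (b - x)) (𝓝[>] x) (𝓝 0) := by
    have : Tendsto (fun b : ℝ => C * (b - x)) (𝓝 x) (𝓝 (C * (x - x))) :=
      Continuous.tendsto (by fun_prop) x
    rw [sub_self, mul_zero] at this
    exact this.mono_left nhdsWithin_le_nhds
  have h0 : Real.pi / 2 * ν.real {x} ≤ 0 := ge_of_tendsto hlim0 (by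
    filter_upwards [Ioo_mem_nhdsGT hxc] with b hb using hle b hb)
  have h1 : ν.real {x} = 0 :=
    le_antisymm (by
      by_contra h
      exact absurd h0 (not_le.2 (mul_pos (by positivity) (not_le.1 h)))) measureReal_nonneg
  exact (measureReal_eq_zero_iff isCompact_singleton.measure_lt_top.ne).1 h1

/-- The Stieltjes inversion formula: where the function with Poisson representation `u` has boundary
values `w`, the representing measure is absolutely continuous with density `w / π`. -/
theorem restrict_eq_withDensity_boundaryValue
    (hν : Integrable (fun t : ℝ => 1 / (1 + t ^ 2)) ν)
    (hu : ∀ z : ℂ, 0 < z.im → u z = β * z.im + ∫ t, poissonKernel z.im z.re t ∂ν)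
    {U : Set ℝ} (hU : IsOpen U)
    (hlim : ∀ x ∈ U, Tendsto u (𝓝[{z | 0 < z.im}] (x : ℂ)) (𝓝 (w x))) (hw : ∀ x ∈ U, 0 ≤ w x) :
    ν.restrict U = (volume.withDensity fun x => ENNReal.ofReal (w x / Real.pi)).restrict U := by
  have hIoc : ∀ a b : ℝ, Set.Icc a b ⊆ U → ν (Set.Ioc a b) =
      (volume.withDensity fun x => ENNReal.ofReal (w x / Real.pi)) (Set.Ioc a b) := by
    intro a b hU'
    rcases le_or_gt b a with hab | hab
    · simp [Set.Ioc_eq_empty_of_le hab]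
    have hcont := continuousOn_boundaryValue fun y hy => hlim y (hU' hy)
    rw [withDensity_apply _ measurableSet_Ioc, ← ofReal_integral_eq_lintegral_ofReal]
    · rw [← intervalIntegral.integral_of_le hab.le, intervalIntegral.integral_div,
        integral_boundaryValue_eq_measureReal hν hu hab fun y hy => hlim y (hU' hy)]
      have ha := measure_singleton_eq_zero_of_tendsto hν hu hU hlim
        (hU' (Set.left_mem_Icc.2 hab.le))
      have hb := measure_singleton_eq_zero_of_tendsto hν hu hU hlim
        (hU' (Set.right_mem_Icc.2 hab.le))
      -- Without atoms, the closed, open and half-open intervals have the same mass.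
      have h1 : ν (Set.Icc a b) = ν (Set.Ioc a b) :=
        measure_congr (Ioc_ae_eq_Icc' ha).symm
      have h2 : ν (Set.Ioo a b) = ν (Set.Ioc a b) :=
        measure_congr (Ioo_ae_eq_Ioc' hb)
      rw [measureReal_def, measureReal_def, h1, h2]
      have : Real.pi / 2 * ((ν (Set.Ioc a b)).toReal + (ν (Set.Ioc a b)).toReal) / Real.pi =
          (ν (Set.Ioc a b)).toReal := by field_simp; ring
      rw [this, ENNReal.ofReal_toReal measure_Ioc_lt_top.ne]
    · exact ((hcont.div_const _).integrableOn_Icc).mono_set Set.Ioc_subset_Icc_self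
    · refine (ae_restrict_iff' measurableSet_Ioc).2 (Eventually.of_forall fun x hx => ?_)
      exact div_nonneg (hw x (hU' (Set.Ioc_subset_Icc_self hx))) Real.pi_pos.le
  -- Neither measure need be finite on `U`, so `U` is covered by countably many half-open intervals
  -- whose closures lie in `U`, and the measures are compared on each.
  have hloc : ∀ x ∈ U, ∃ ε > 0, Set.Icc (x - ε) (x + ε) ⊆ U := fun x hx => by
    obtain ⟨ε, hε, h⟩ := Metric.isOpen_iff.1 hU x hx
    refine ⟨ε / 2, by positivity, fun y hy => h ?_⟩
    rw [Metric.mem_ball, Real.dist_eq, abs_lt]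
    constructor <;> linarith [hy.1, hy.2]
  choose! ε hε hεU using hloc
  obtain ⟨t, htU, htc, hcov⟩ := TopologicalSpace.countable_cover_nhdsWithin
    (f := fun x => Set.Ioc (x - ε x) (x + ε x)) (s := U) fun x hx =>
      mem_nhdsWithin_of_mem_nhds (Ioc_mem_nhds (by linarith [hε x hx]) (by linarith [hε x hx]))
  have hUeq : U = ⋃ x ∈ t, Set.Ioc (x - ε x) (x + ε x) :=
    hcov.antisymm (Set.iUnion₂_subset fun x hx =>
      Set.Ioc_subset_Icc_self.trans (hεU x (htU hx)))
  rw [hUeq, Measure.restrict_biUnion_congr htc]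
  intro x hx
  have : IsFiniteMeasure (ν.restrict (Set.Ioc (x - ε x) (x + ε x))) :=
    ⟨by rw [Measure.restrict_apply_univ]; exact measure_Ioc_lt_top⟩
  refine Measure.ext_of_Ioc _ _ fun a b _ => ?_
  rw [Measure.restrict_apply measurableSet_Ioc, Measure.restrict_apply measurableSet_Ioc,
    Set.Ioc_inter_Ioc]
  exact hIoc _ _ ((Set.Icc_subset_Icc le_sup_right inf_le_right).trans (hεU x (htU hx)))

end Inversion

/-! ### The fixed point equation and the square root of its discriminant -/

/-- The open upper half plane. -/
abbrev upperHalf : Set ℂ := {z | 0 < z.im}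

theorem isOpen_upperHalf : IsOpen upperHalf := isOpen_lt continuous_const Complex.continuous_im

theorem convex_upperHalf : Convex ℝ upperHalf := convex_halfSpace_im_gt 0

/-- The discriminant `(tr T)² - 4`. -/
noncomputable def disc (T : ℂ → Matrix.SpecialLinearGroup (Fin 2) ℂ) (z : ℂ) : ℂ :=
  (T z).1.trace ^ 2 - 4

/-- The symmetric matrix of the quadratic form whose roots are the fixed points of `T(z)`. -/
noncomputable def fixMatrix (T : ℂ → Matrix.SpecialLinearGroup (Fin 2) ℂ) (z : ℂ) :
    Matrix (Fin 2) (Fin 2) ℂ :=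
  !![-(T z).1 1 0, ((T z).1 0 0 - (T z).1 1 1) / 2;
    ((T z).1 0 0 - (T z).1 1 1) / 2, (T z).1 0 1]

/-- Since `det T = 1`, this identifies `(tr T)² - 4` with the discriminant of the fixed point
equation. -/
theorem disc_eq (T : ℂ → Matrix.SpecialLinearGroup (Fin 2) ℂ) (z : ℂ) :
    disc T z = ((T z).1 0 0 - (T z).1 1 1) ^ 2 + 4 * (T z).1 0 1 * (T z).1 1 0 := by
  have h := (T z).2
  rw [Matrix.det_fin_two] at h
  rw [disc, Matrix.trace_fin_two]
  linear_combination (4 : ℂ) * h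

/-- The source of multiplicity 2: the numerator of `M` is invertible wherever the discriminant is
nonzero. -/
theorem det_fixMatrix (T : ℂ → Matrix.SpecialLinearGroup (Fin 2) ℂ) (z : ℂ) :
    (fixMatrix T z).det = -disc T z / 4 := by
  rw [disc_eq, fixMatrix, Matrix.det_fin_two_of]
  ring

theorem fixed_some {g : Matrix.SpecialLinearGroup (Fin 2) ℂ} {w : ℂ}
    (h : (OnePoint.some w : OnePoint ℂ) =
      (g : Matrix.GeneralLinearGroup (Fin 2) ℂ) • (OnePoint.some w : OnePoint ℂ)) :
    g.1 1 0 * w ^ 2 + (g.1 1 1 - g.1 0 0) * w - g.1 0 1 = 0 := by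
  rw [OnePoint.smul_some_eq_ite] at h
  by_cases h0 : (g : Matrix.GeneralLinearGroup (Fin 2) ℂ) 1 0 * w +
      (g : Matrix.GeneralLinearGroup (Fin 2) ℂ) 1 1 = 0
  · rw [if_pos h0] at h
    exact absurd h (OnePoint.coe_ne_infty w)
  · rw [if_neg h0, OnePoint.coe_eq_coe, eq_div_iff h0] at h
    change w * (g.1 1 0 * w + g.1 1 1) = g.1 0 0 * w + g.1 0 1 at h
    linear_combination h

theorem fixed_infty {g : Matrix.SpecialLinearGroup (Fin 2) ℂ}
    (h : (OnePoint.infty : OnePoint ℂ) =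
      (g : Matrix.GeneralLinearGroup (Fin 2) ℂ) • (OnePoint.infty : OnePoint ℂ)) :
    g.1 1 0 = 0 := by
  have := OnePoint.smul_infty_eq_self_iff.1 h.symm
  simpa using this

theorem neg_some (v : ℂ) : neg (OnePoint.some v) = OnePoint.some (-v) := rfl

theorem neg_infty : neg OnePoint.infty = OnePoint.infty := rfl

/-- A holomorphic function on the upper half plane with nonnegative imaginary part has no zeros
unless it vanishes identically. -/
theorem ne_zero_of_im_nonneg {f : ℂ → ℂ} (hf : DifferentiableOn ℂ f upperHalf)
    (him : ∀ z : ℂ, 0 < z.im → 0 ≤ (f z).im) (hne : ∃ z : ℂ, 0 < z.im ∧ f z ≠ 0) {z : ℂ}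
    (hz : 0 < z.im) : f z ≠ 0 := by
  intro h0
  obtain ⟨z₁, hz₁, hne⟩ := hne
  rcases (hf.analyticOnNhd isOpen_upperHalf).is_constant_or_isOpen convex_upperHalf.isPreconnected
    with ⟨w, hw⟩ | hopen
  · exact hne (by rw [hw z₁ hz₁, ← hw z hz, h0])
  · have h1 : f '' upperHalf ∈ 𝓝 (0 : ℂ) :=
      (hopen _ subset_rfl isOpen_upperHalf).mem_nhds ⟨z, hz, h0⟩
    obtain ⟨ε, hε, hb⟩ := Metric.mem_nhds_iff.1 h1
    obtain ⟨v, hv, hv'⟩ := hb (show (-(ε / 2 : ℝ) * Complex.I : ℂ) ∈ Metric.ball 0 ε by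
      rw [mem_ball_zero_iff, norm_mul, norm_neg, Complex.norm_real, Complex.norm_I, mul_one,
        Real.norm_of_nonneg (by positivity)]
      linarith)
    have := him v hv
    rw [hv'] at this
    simp at this
    linarith

section Sqrt

variable {mp mm : ℂ → OnePoint ℂ} {T : ℂ → Matrix.SpecialLinearGroup (Fin 2) ℂ}

/-- If `m₊` and `-m₋` are the fixed points of `T`, then `M = N / s`, where `N` is the matrix of the
fixed point equation and `s` is a holomorphic square root of its discriminant. -/
theorem exists_sqrt_disc (hmp : IsHerglotz mp) (hmm : IsHerglotz mm)
    (hne : ∃ z : ℂ, 0 < z.im ∧ mp z ≠ neg (mm z)) (hT : IsEntireSL T)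
    (hfix : ∀ z : ℂ, 0 < z.im →
      mp z = (T z : Matrix.GeneralLinearGroup (Fin 2) ℂ) • mp z ∧
      neg (mm z) = (T z : Matrix.GeneralLinearGroup (Fin 2) ℂ) • neg (mm z)) :
    ∃ s : ℂ → ℂ, DifferentiableOn ℂ s upperHalf ∧ ∀ z : ℂ, 0 < z.im →
      s z ^ 2 = disc T z ∧
      (∀ i j, matrixM (mp z) (mm z) i j * s z = fixMatrix T z i j) ∧
      ((T z).1 1 0 ≠ 0 → ∃ f g, mp z = OnePoint.some f ∧ mm z = OnePoint.some g ∧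
        2 * (T z).1 1 0 * f = (T z).1 0 0 - (T z).1 1 1 + s z ∧
        2 * (T z).1 1 0 * g = s z - ((T z).1 0 0 - (T z).1 1 1)) := by
  have hd : ∀ i j, DifferentiableOn ℂ (fun z => (T z).1 i j) upperHalf :=
    fun i j => (hT.1 i j).differentiableOn
  obtain ⟨z₁, hz₁, hne⟩ := hne
  rcases hmp with hp | ⟨f, hf, hp⟩ <;> rcases hmm with hm | ⟨g, hg, hm⟩
  · rw [hp z₁ hz₁, hm z₁ hz₁, neg_infty] at hne
    exact absurd rfl hne
  -- If `∞` is fixed then `c = 0` and the discriminant is the perfect square `(a - d)²`; the sign of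
  -- the root is dictated by the off-diagonal entry of `M`.
  · refine ⟨fun z => (T z).1 0 0 - (T z).1 1 1, (hd 0 0).sub (hd 1 1), fun z hz => ?_⟩
    obtain ⟨h1, h2⟩ := hfix z hz
    rw [hp z hz] at h1
    rw [(hm z hz).2, neg_some] at h2
    have hc := fixed_infty h1
    have hq := fixed_some h2
    rw [hc] at hq
    refine ⟨by rw [disc_eq, hc]; ring, ?_, fun h => absurd hc h⟩
    rw [hp z hz, (hm z hz).2]
    intro i j
    fin_cases i <;> fin_cases j <;> simp [matrixM, fixMatrix, hc] <;>
      first | linear_combination hq | ring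
  · refine ⟨fun z => -((T z).1 0 0 - (T z).1 1 1), ((hd 0 0).sub (hd 1 1)).neg, fun z hz => ?_⟩
    obtain ⟨h1, h2⟩ := hfix z hz
    rw [(hp z hz).2] at h1
    rw [hm z hz, neg_infty] at h2
    have hc := fixed_infty h2
    have hq := fixed_some h1
    rw [hc] at hq
    refine ⟨by rw [disc_eq, hc]; ring, ?_, fun h => absurd hc h⟩
    rw [hm z hz, (hp z hz).2]
    intro i j
    fin_cases i <;> fin_cases j <;> simp [matrixM, fixMatrix, hc] <;>
      first | linear_combination hq | ring
  · have hsum : ∀ z : ℂ, 0 < z.im → f z + g z ≠ 0 := fun z hz =>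
      ne_zero_of_im_nonneg (hf.add hg)
        (fun z hz => by
          rw [Pi.add_apply, Complex.add_im]; exact add_nonneg (hp z hz).1 (hm z hz).1)
        ⟨z₁, hz₁, fun h => hne (by
          rw [(hp z₁ hz₁).2, (hm z₁ hz₁).2, neg_some, eq_neg_of_add_eq_zero_left h])⟩ hz
    -- The difference of the two roots `f` and `-g`, multiplied by the leading coefficient, is a
    -- square root of the discriminant.
    refine ⟨fun z => (T z).1 1 0 * (f z + g z), (hd 1 0).mul (hf.add hg), fun z hz => ?_⟩
    obtain ⟨h1, h2⟩ := hfix z hz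
    have h0 := hsum z hz
    rw [(hp z hz).2] at h1
    rw [(hm z hz).2, neg_some] at h2
    have hq := fixed_some h1
    have hr := fixed_some h2
    -- Vieta: the difference of the two fixed point equations is divisible by `f + g`, which has no
    -- zeros.
    have hdiff : (T z).1 1 0 * (f z - g z) = (T z).1 0 0 - (T z).1 1 1 :=
      mul_left_cancel₀ h0 (by linear_combination hq - hr)
    have hprod : (T z).1 1 0 * (f z * g z) = (T z).1 0 1 := by
      linear_combination hq - f z * hdiff
    refine ⟨?_, ?_, fun hc => ⟨f z, g z, (hp z hz).2, (hm z hz).2, ?_, ?_⟩⟩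
    · rw [disc_eq, ← hdiff, ← hprod]; ring
    · rw [(hm z hz).2, (hp z hz).2]
      intro i j
      fin_cases i <;> fin_cases j <;> simp [matrixM, fixMatrix, ← hdiff, ← hprod] <;> field_simp
    · rw [← hdiff]; ring
    · rw [← hdiff]; ring

theorem differentiable_fixMatrix (hT : IsEntireSL T) (i j : Fin 2) :
    Differentiable ℂ fun z => fixMatrix T z i j := by
  have h := hT.1
  fin_cases i <;> fin_cases j
  · exact (h 1 0).neg
  · exact ((h 0 0).sub (h 1 1)).div_const 2
  · exact ((h 0 0).sub (h 1 1)).div_const 2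
  · exact h 0 1

theorem differentiable_disc (hT : IsEntireSL T) : Differentiable ℂ (disc T) := by
  have h : disc T = fun z => ((T z).1 0 0 - (T z).1 1 1) ^ 2 + 4 * (T z).1 0 1 * (T z).1 1 0 :=
    funext (disc_eq T)
  rw [h]
  have h1 := hT.1
  exact (((h1 0 0).sub (h1 1 1)).pow 2).add (((h1 0 1).const_mul 4).mul (h1 1 0))

theorem eq_zero_of_upperHalf {f : ℂ → ℂ} (hf : Differentiable ℂ f)
    (h : ∀ z : ℂ, 0 < z.im → f z = 0) (z : ℂ) : f z = 0 := by
  have hf' : AnalyticOnNhd ℂ f Set.univ := hf.differentiableOn.analyticOnNhd isOpen_univ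
  exact hf'.eqOn_zero_of_preconnected_of_eventuallyEq_zero isPreconnected_univ (Set.mem_univ Complex.I)
    (eventually_of_mem (isOpen_upperHalf.mem_nhds (by simp : Complex.I ∈ upperHalf)) h)
    (Set.mem_univ z)

/-- If the fixed point equation is trivial on the upper half plane, then `T ≡ ±1`. -/
theorem eq_one_or_neg_one (hT : IsEntireSL T)
    (h : ∀ z : ℂ, 0 < z.im → fixMatrix T z = 0) : (∀ z, T z = 1) ∨ ∀ z, T z = -1 := by
  have h0 : ∀ i j z, fixMatrix T z i j = 0 := fun i j z =>
    eq_zero_of_upperHalf (differentiable_fixMatrix hT i j) (fun z hz => by rw [h z hz]; rfl) z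
  have hc : ∀ z, (T z).1 1 0 = 0 := fun z => by simpa [fixMatrix] using h0 0 0 z
  have hb : ∀ z, (T z).1 0 1 = 0 := fun z => by simpa [fixMatrix] using h0 1 1 z
  have hd : ∀ z, (T z).1 1 1 = (T z).1 0 0 := fun z => by
    have := h0 0 1 z
    simp only [fixMatrix, Matrix.of_apply, Matrix.cons_val', Matrix.cons_val_zero,
      Matrix.cons_val_one, Matrix.cons_val_fin_one] at this
    linear_combination (-2 : ℂ) * this
  have hsq : ∀ z, (T z).1 0 0 ^ 2 = 1 := fun z => by
    have := (T z).2
    rw [Matrix.det_fin_two, hc, hb, hd] at this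
    linear_combination this
  -- Now `T = a · 1` with `a² = 1`; by connectedness the sign does not depend on `z`.
  rcases isPreconnected_univ.eq_one_or_eq_neg_one_of_sq_eq
    (hT.1 0 0).continuous.continuousOn (fun z _ => hsq z) with h1 | h1
  · refine Or.inl fun z => Matrix.SpecialLinearGroup.ext _ _ fun i j => ?_
    have := h1 (Set.mem_univ z)
    fin_cases i <;> fin_cases j <;> simp_all
  · refine Or.inr fun z => Matrix.SpecialLinearGroup.ext _ _ fun i j => ?_
    have := h1 (Set.mem_univ z)
    fin_cases i <;> fin_cases j <;> simp_all

end Sqrt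

/-! ### Boundary values of the square root; closed sets with discrete boundary -/

/-- A holomorphic square root on the upper half plane extends continuously to the real points where
the radicand does not vanish. -/
theorem exists_tendsto_sqrt {s D : ℂ → ℂ} (hs : ContinuousOn s upperHalf) (hD : Continuous D)
    (hsq : ∀ z : ℂ, 0 < z.im → s z ^ 2 = D z) {x : ℝ} (hx : D x ≠ 0) :
    ∃ σ : ℂ, σ ^ 2 = D x ∧ Tendsto s (𝓝[upperHalf] (x : ℂ)) (𝓝 σ) := by
  obtain ⟨σ, hσ⟩ := IsAlgClosed.exists_pow_nat_eq (D x) (n := 2) two_pos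
  have hquot : Continuous fun z => D z / D x := hD.div_const _
  obtain ⟨ε, hε, hball⟩ := Metric.isOpen_iff.1 (Complex.isOpen_slitPlane.preimage hquot) (x : ℂ)
    (by simp [div_self hx])
  -- A continuous square root of `D` on a full disc around `x`: the principal branch is applied to
  -- `D z / D x`, which is close to `1`.
  set r : ℂ → ℂ := fun z => σ * (D z / D x) ^ (1 / 2 : ℂ) with hr
  have hrc : ContinuousOn r (Metric.ball (x : ℂ) ε) := fun z hz =>
    (continuousAt_const.mul (ContinuousAt.comp (g := fun w : ℂ => w ^ (1 / 2 : ℂ))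
      (f := fun z => D z / D x) (continuousAt_cpow_const (hball hz))
      hquot.continuousAt)).continuousWithinAt
  have hrsq : ∀ z, r z ^ 2 = D z := fun z => by
    have : ((D z / D x) ^ (1 / 2 : ℂ)) ^ 2 = D z / D x := by
      rw [one_div]
      exact Complex.cpow_nat_inv_pow _ two_ne_zero
    rw [hr, mul_pow, hσ, this, mul_div_cancel₀ _ hx]
  have hrx : r x = σ := by simp [hr, div_self hx]
  have hrne : ∀ z ∈ Metric.ball (x : ℂ) ε, r z ≠ 0 := fun z hz h0 => by
    have h1 : D z / D x ≠ 0 := Complex.slitPlane_ne_zero (hball hz)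
    exact h1 (by rw [← hrsq z, h0]; simp)
  have hlim : Tendsto r (𝓝[upperHalf] (x : ℂ)) (𝓝 σ) := by
    have := (hrc.continuousAt (Metric.ball_mem_nhds _ hε)).tendsto
    rw [hrx] at this
    exact this.mono_left nhdsWithin_le_nhds
  have hmem : Metric.ball (x : ℂ) ε ∩ upperHalf ∈ 𝓝[upperHalf] (x : ℂ) :=
    inter_mem (mem_nhdsWithin_of_mem_nhds (Metric.ball_mem_nhds _ hε)) self_mem_nhdsWithin
  -- On the connected half disc, `s` and `r` have the same nonvanishing square, so they agree up to
  -- one global sign.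
  rcases ((convex_ball (x : ℂ) ε).inter convex_upperHalf).isPreconnected.eq_or_eq_neg_of_sq_eq
    (hs.mono Set.inter_subset_right) (hrc.mono Set.inter_subset_left)
    (fun z hz => by simp only [Pi.pow_apply]; rw [hsq z hz.2, hrsq])
    (fun {z} hz => hrne z hz.1) with h | h
  · exact ⟨σ, hσ, hlim.congr' (eventually_of_mem hmem fun z hz => (h hz).symm)⟩
  · exact ⟨-σ, by rw [neg_sq, hσ], hlim.neg.congr' (eventually_of_mem hmem fun z hz => (h hz).symm)⟩

/-- The intervals are the connected components of `E`. A point outside `Z` has a neighbourhood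
inside `E`, hence is interior to its component, so `Z` contains all endpoints. -/
theorem isUnionOfIntervals_of_frontier {E Z : Set ℝ} (hE : IsClosed E)
    (hZ : ∀ x ∈ E, x ∉ Z → E ∈ 𝓝 x) (hacc : ∀ x, ¬ AccPt x (𝓟 Z)) : IsUnionOfIntervals E := by
  have hclosed : ∀ x ∈ E, IsClosed (connectedComponentIn E x) := fun x hx => by
    refine isClosed_of_closure_subset ?_
    exact isPreconnected_connectedComponentIn.closure.subset_connectedComponentIn
      (subset_closure (mem_connectedComponentIn hx))
      (closure_minimal (connectedComponentIn_subset E x) hE)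
  refine ⟨(fun x => connectedComponentIn E x) '' E, ?_, ?_, ?_, fun x h => hacc x (h.mono ?_)⟩
  · rintro _ ⟨x, hx, rfl⟩
    exact ⟨⟨x, mem_connectedComponentIn hx⟩, hclosed x hx,
      isPreconnected_connectedComponentIn.ordConnected⟩
  · rintro _ ⟨x, hx, rfl⟩ _ ⟨y, hy, rfl⟩ hne
    refine Set.disjoint_left.2 fun z hzx hzy => hne ?_
    exact (connectedComponentIn_eq hzx).trans (connectedComponentIn_eq hzy).symm
  · refine Set.Subset.antisymm (Set.sUnion_subset ?_) fun x hx =>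
      ⟨_, ⟨x, hx, rfl⟩, mem_connectedComponentIn hx⟩
    rintro _ ⟨x, hx, rfl⟩
    exact connectedComponentIn_subset E x
  · refine principal_mono.2 (Set.iUnion₂_subset ?_)
    rintro _ ⟨x, hx, rfl⟩ y hy
    have hyI : y ∈ connectedComponentIn E x := (hclosed x hx).frontier_subset hy
    by_contra hyZ
    have h1 := connectedComponentIn_mem_nhds (hZ y (connectedComponentIn_subset _ _ hyI) hyZ)
    rw [← connectedComponentIn_eq hyI] at h1
    exact hy.2 (mem_interior_iff_mem_nhds.2 h1)

/-- Every point has a neighbourhood meeting `Z` at most in that point; by the Lindelöf property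
countably many of these cover `Z`. -/
theorem countable_of_not_accPt {Z : Set ℝ} (hacc : ∀ x, ¬ AccPt x (𝓟 Z)) : Z.Countable := by
  have h : ∀ x, ∃ U ∈ 𝓝 x, ∀ y ∈ U ∩ Z, y = x := fun x => by
    have := hacc x
    rw [accPt_iff_nhds] at this
    push Not at this
    exact this
  choose U hU hUZ using h
  obtain ⟨t, -, htc, hcov⟩ := TopologicalSpace.countable_cover_nhdsWithin (f := U) (s := Z)
    fun x _ => mem_nhdsWithin_of_mem_nhds (hU x)
  refine htc.mono fun y hy => ?_
  obtain ⟨x, hx, hyx⟩ := Set.mem_iUnion₂.1 (hcov hy)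
  rwa [hUZ x y ⟨hyx, hy⟩]

/-! ### The discriminant on the real line, the bands, and reflectionlessness -/

section Real

variable {T : ℂ → Matrix.SpecialLinearGroup (Fin 2) ℂ}

theorem fixMatrix_im (hT : IsEntireSL T) (x : ℝ) (i j : Fin 2) : (fixMatrix T x i j).im = 0 := by
  have h := hT.2 x
  fin_cases i <;> fin_cases j <;> simp [fixMatrix, h]

theorem disc_im (hT : IsEntireSL T) (x : ℝ) : (disc T x).im = 0 := by
  have h := hT.2 x
  simp [disc_eq, h, pow_two]

theorem disc_ofReal (hT : IsEntireSL T) (x : ℝ) : disc T x = ((disc T x).re : ℂ) :=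
  Complex.ext rfl (by rw [disc_im hT, Complex.ofReal_im])

/-- Replaces the trace condition by the sign of an entire function that is real on the real line. -/
theorem mem_bandSet_iff (hT : IsEntireSL T) {x : ℝ} : x ∈ bandSet T ↔ (disc T x).re ≤ 0 := by
  have h : ((T x).1.trace).im = 0 := by
    rw [Matrix.trace_fin_two, Complex.add_im, hT.2 x, hT.2 x, add_zero]
  have h2 : (disc T x).re = ((T x).1.trace).re ^ 2 - 4 := by
    simp [disc, pow_two, h]
  rw [h2, bandSet, Set.mem_ofPred_eq, ← abs_le, ← sq_le_sq₀ (abs_nonneg _) two_pos.le, sq_abs]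
  constructor <;> intro h <;> linarith

/-- The real zeros of the discriminant. -/
def discZeros (T : ℂ → Matrix.SpecialLinearGroup (Fin 2) ℂ) : Set ℝ := {x | disc T x = 0}

theorem continuous_disc_re (hT : IsEntireSL T) : Continuous fun x : ℝ => (disc T x).re :=
  Complex.continuous_re.comp ((differentiable_disc hT).continuous.comp Complex.continuous_ofReal)

theorem isClosed_bandSet (hT : IsEntireSL T) : IsClosed (bandSet T) := by
  have : bandSet T = {x : ℝ | (disc T x).re ≤ 0} := Set.ext fun x => mem_bandSet_iff hT
  rw [this]
  exact isClosed_le (continuous_disc_re hT) continuous_const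

theorem isClosed_discZeros (hT : IsEntireSL T) : IsClosed (discZeros T) :=
  isClosed_eq ((differentiable_disc hT).continuous.comp Complex.continuous_ofReal) continuous_const

theorem not_accPt_discZeros (hT : IsEntireSL T) (hne : ∃ z, disc T z ≠ 0) (x : ℝ) :
    ¬ AccPt x (𝓟 (discZeros T)) := by
  intro h
  have h1 : ∃ᶠ z in 𝓝[≠] (x : ℂ), disc T z = 0 := by
    have ht : Tendsto (Complex.ofReal) (𝓝[≠] x) (𝓝[≠] (x : ℂ)) :=
      Complex.continuous_ofReal.continuousWithinAt.tendsto_nhdsWithin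
        fun y hy => by simpa using hy
    exact ht.frequently (accPt_iff_frequently_nhdsNE.1 h)
  obtain ⟨z, hz⟩ := hne
  have hA : AnalyticOnNhd ℂ (disc T) Set.univ :=
    (differentiable_disc hT).differentiableOn.analyticOnNhd isOpen_univ
  exact hz (hA.eqOn_zero_of_preconnected_of_frequently_eq_zero isPreconnected_univ
    (Set.mem_univ (x : ℂ)) h1 (Set.mem_univ z))

theorem disc_re_neg (hT : IsEntireSL T) {x : ℝ} (hx : x ∈ bandSet T) (hZ : x ∉ discZeros T) :
    (disc T x).re < 0 :=
  lt_of_le_of_ne ((mem_bandSet_iff hT).1 hx) fun h => hZ (by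
    rw [discZeros, Set.mem_ofPred_eq, disc_ofReal hT, h, Complex.ofReal_zero])

theorem bandSet_mem_nhds (hT : IsEntireSL T) {x : ℝ} (hx : x ∈ bandSet T) (hZ : x ∉ discZeros T) :
    bandSet T ∈ 𝓝 x := by
  have h := disc_re_neg hT hx hZ
  filter_upwards [(continuous_disc_re hT).continuousAt.eventually_lt_const h] with y hy
  exact (mem_bandSet_iff hT).2 hy.le

theorem isUnionOfIntervals_bandSet (hT : IsEntireSL T) (hne : ∃ z, disc T z ≠ 0) :
    IsUnionOfIntervals (bandSet T) :=
  isUnionOfIntervals_of_frontier (isClosed_bandSet hT) (fun _ => bandSet_mem_nhds hT)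
    (not_accPt_discZeros hT hne)

/-- Inside the bands the boundary value of `s` is purely imaginary; the next lemma gives the
opposite alternative for the gaps. -/
theorem re_eq_zero_of_sq_neg {σ : ℂ} {d : ℝ} (hd : d < 0) (h : σ ^ 2 = d) : σ.re = 0 := by
  have him := congrArg Complex.im h
  have hre := congrArg Complex.re h
  simp only [pow_two, Complex.mul_re, Complex.mul_im, Complex.ofReal_re, Complex.ofReal_im] at him hre
  by_contra h0
  have : σ.im = 0 := by
    have : σ.re * σ.im = 0 := by linarith
    exact (mul_eq_zero.1 this).resolve_left h0
  rw [this] at hre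
  nlinarith [mul_self_nonneg σ.re]

theorem im_eq_zero_of_sq_pos {σ : ℂ} {d : ℝ} (hd : 0 < d) (h : σ ^ 2 = d) : σ.im = 0 := by
  have him := congrArg Complex.im h
  have hre := congrArg Complex.re h
  simp only [pow_two, Complex.mul_re, Complex.mul_im, Complex.ofReal_re, Complex.ofReal_im] at him hre
  by_contra h0
  have : σ.re = 0 := by
    have : σ.re * σ.im = 0 := by linarith
    exact (mul_eq_zero.1 this).resolve_right h0
  rw [this] at hre
  nlinarith [mul_self_nonneg σ.im]

/-- The boundary values of `m₊` and `m₋` are `(±(a - d) + σ) / (2c)` with `a, c, d` real and `σ`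
purely imaginary, so `w ↦ -conj w` takes one to the other. -/
theorem reflectionless_bandSet {mp mm : ℂ → OnePoint ℂ} {s : ℂ → ℂ} (hT : IsEntireSL T)
    (hne : ∃ z, disc T z ≠ 0) (hs : DifferentiableOn ℂ s upperHalf)
    (hsq : ∀ z : ℂ, 0 < z.im → s z ^ 2 = disc T z)
    (hm : ∀ z : ℂ, 0 < z.im → (T z).1 1 0 ≠ 0 → ∃ f g, mp z = OnePoint.some f ∧
        mm z = OnePoint.some g ∧ 2 * (T z).1 1 0 * f = (T z).1 0 0 - (T z).1 1 1 + s z ∧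
        2 * (T z).1 1 0 * g = s z - ((T z).1 0 0 - (T z).1 1 1)) :
    Reflectionless mp mm (bandSet T) := by
  have hZ : ∀ᵐ x : ℝ, x ∉ discZeros T :=
    measure_eq_zero_iff_ae_notMem.1
      ((countable_of_not_accPt (not_accPt_discZeros hT hne)).measure_zero _)
  filter_upwards [hZ] with x hxZ hxE
  have hneg := disc_re_neg hT hxE hxZ
  obtain ⟨σ, hσ, hlim⟩ := exists_tendsto_sqrt hs.continuousOn (differentiable_disc hT).continuous
    hsq hxZ
  have hσre : σ.re = 0 := re_eq_zero_of_sq_neg hneg (by rw [hσ, ← disc_ofReal hT])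
  have hreal : ∀ i j, (starRingEnd ℂ) ((T x).1 i j) = (T x).1 i j := fun i j =>
    Complex.conj_eq_iff_im.2 (hT.2 x i j)
  have hσconj : (starRingEnd ℂ) σ = -σ := Complex.ext (by simp [hσre]) (by simp)
  -- If `c = 0`, the discriminant would be the square of a real number.
  have hc : (T x).1 1 0 ≠ 0 := fun hc => by
    have h1 : (disc T x).re = (((T x).1 0 0 - (T x).1 1 1).re) ^ 2 := by
      have := hT.2 x
      simp [disc_eq, hc, pow_two, this]
    rw [h1] at hneg
    exact absurd hneg (not_lt.2 (sq_nonneg _))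
  have hvert := tendsto_vertical x
  have hT' : ∀ i j, Tendsto (fun z => (T z).1 i j) (𝓝[upperHalf] (x : ℂ)) (𝓝 ((T x).1 i j)) :=
    fun i j => (hT.1 i j).continuous.continuousAt.mono_left nhdsWithin_le_nhds
  have hev : ∀ᶠ z in 𝓝[upperHalf] (x : ℂ), (T z).1 1 0 ≠ 0 ∧ 0 < z.im :=
    ((hT' 1 0).eventually_ne hc).and self_mem_nhdsWithin
  have hlf : Tendsto mp (𝓝[upperHalf] (x : ℂ)) (𝓝 (OnePoint.some
      (((T x).1 0 0 - (T x).1 1 1 + σ) / (2 * (T x).1 1 0)))) := by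
    have h1 := ((((hT' 0 0).sub (hT' 1 1)).add hlim).div ((hT' 1 0).const_mul 2)
      (mul_ne_zero two_ne_zero hc))
    refine ((OnePoint.continuous_coe.tendsto _).comp h1).congr' ?_
    filter_upwards [hev] with z hz
    obtain ⟨f, g, hf, -, h, -⟩ := hm z hz.2 hz.1
    rw [hf]
    simp only [Function.comp_apply, Pi.div_apply]
    rw [← h, mul_div_cancel_left₀ _ (mul_ne_zero two_ne_zero hz.1)]
  have hlg : Tendsto mm (𝓝[upperHalf] (x : ℂ)) (𝓝 (OnePoint.some
      ((σ - ((T x).1 0 0 - (T x).1 1 1)) / (2 * (T x).1 1 0)))) := by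
    have h1 := ((hlim.sub ((hT' 0 0).sub (hT' 1 1))).div ((hT' 1 0).const_mul 2)
      (mul_ne_zero two_ne_zero hc))
    refine ((OnePoint.continuous_coe.tendsto _).comp h1).congr' ?_
    filter_upwards [hev] with z hz
    obtain ⟨f, g, -, hg, -, h⟩ := hm z hz.2 hz.1
    rw [hg]
    simp only [Function.comp_apply, Pi.div_apply]
    rw [← h, mul_div_cancel_left₀ _ (mul_ne_zero two_ne_zero hz.1)]
  refine ⟨_, hlg.comp hvert, ?_⟩
  have hconj : negConj (OnePoint.some ((σ - ((T x).1 0 0 - (T x).1 1 1)) / (2 * (T x).1 1 0))) =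
      OnePoint.some (((T x).1 0 0 - (T x).1 1 1 + σ) / (2 * (T x).1 1 0)) := by
    change OnePoint.some (-(starRingEnd ℂ) _) = _
    rw [map_div₀, map_sub, map_sub, map_mul, hreal, hreal, hreal, hσconj, map_ofNat]
    congr 1
    ring
  rw [hconj]
  exact hlf.comp hvert

end Real

/-! ### The Herglotz kernel and recovery of point masses -/

/-- The kernel `1 / (t - z) - t / (1 + t²)` of the Herglotz representation. -/
noncomputable def herglotzKernel (z : ℂ) (t : ℝ) : ℂ := 1 / (t - z) - t / (1 + t ^ 2)

theorem ofReal_sub_ne_zero {z : ℂ} (hz : 0 < z.im) (t : ℝ) : (t : ℂ) - z ≠ 0 := fun h => by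
  have := congrArg Complex.im h
  simp at this
  exact hz.ne' this

theorem one_add_ofReal_sq_ne_zero (t : ℝ) : (1 + (t : ℂ) ^ 2) ≠ 0 := by
  have : (1 + t ^ 2 : ℝ) ≠ 0 := by positivity
  exact_mod_cast this

theorem continuous_herglotzKernel {z : ℂ} (hz : 0 < z.im) : Continuous (herglotzKernel z) := by
  unfold herglotzKernel
  exact (continuous_const.div (by fun_prop) (ofReal_sub_ne_zero hz)).sub
    (Complex.continuous_ofReal.div (by fun_prop) one_add_ofReal_sq_ne_zero)

theorem herglotzKernel_eq {z : ℂ} (hz : 0 < z.im) (t : ℝ) :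
    herglotzKernel z t = (1 + t * z) / ((t - z) * (1 + t ^ 2)) := by
  have h1 := ofReal_sub_ne_zero hz t
  have h2 := one_add_ofReal_sq_ne_zero t
  unfold herglotzKernel
  field_simp
  ring

theorem im_le_norm_ofReal_sub (z : ℂ) (t : ℝ) : z.im ≤ ‖(t : ℂ) - z‖ := by
  have := Complex.abs_im_le_norm ((t : ℂ) - z)
  rw [Complex.sub_im, Complex.ofReal_im, zero_sub, abs_neg] at this
  exact (le_abs_self _).trans this

/-- Write `1 + t z = (1 + z²) + z (t - z)` and use `Im z ≤ |t - z|`. The constant stays bounded as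
`z` approaches the real line, so this serves both for integrability at fixed `z` and as a dominating
bound in vertical limits. -/
theorem norm_im_mul_herglotzKernel_le {z : ℂ} (hz : 0 < z.im) (t : ℝ) :
    ‖(z.im : ℂ) * herglotzKernel z t‖ ≤ (‖1 + z ^ 2‖ + ‖z‖ * z.im) * (1 / (1 + t ^ 2)) := by
  have hpos : 0 < ‖(t : ℂ) - z‖ := norm_pos_iff.2 (ofReal_sub_ne_zero hz t)
  have h1 : ‖(1 : ℂ) + (t : ℂ) ^ 2‖ = 1 + t ^ 2 := by
    rw [show (1 : ℂ) + (t : ℂ) ^ 2 = ((1 + t ^ 2 : ℝ) : ℂ) by push_cast; ring, Complex.norm_real,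
      Real.norm_of_nonneg (by positivity)]
  have h2 : ‖(1 : ℂ) + t * z‖ ≤ ‖1 + z ^ 2‖ + ‖z‖ * ‖(t : ℂ) - z‖ := by
    rw [show (1 : ℂ) + t * z = (1 + z ^ 2) + z * (t - z) by ring, ← norm_mul]
    exact norm_add_le _ _
  rw [herglotzKernel_eq hz, norm_mul, norm_div, norm_mul, h1, Complex.norm_real,
    Real.norm_of_nonneg hz.le]
  have h3 : z.im * ‖(1 : ℂ) + t * z‖ ≤ (‖1 + z ^ 2‖ + ‖z‖ * z.im) * ‖(t : ℂ) - z‖ := by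
    nlinarith [im_le_norm_ofReal_sub z t, norm_nonneg (1 + z ^ 2)]
  calc z.im * (‖(1 : ℂ) + t * z‖ / (‖(t : ℂ) - z‖ * (1 + t ^ 2)))
      = z.im * ‖(1 : ℂ) + t * z‖ / ‖(t : ℂ) - z‖ * (1 / (1 + t ^ 2)) := by field_simp
    _ ≤ _ := by
      gcongr
      rwa [div_le_iff₀ hpos]

theorem im_herglotzKernel (z : ℂ) (t : ℝ) :
    (herglotzKernel z t).im = poissonKernel z.im z.re t := by
  have h2 : ((t : ℂ) / (1 + (t : ℂ) ^ 2)).im = 0 := by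
    rw [show (t : ℂ) / (1 + (t : ℂ) ^ 2) = ((t / (1 + t ^ 2) : ℝ) : ℂ) by push_cast; ring,
      Complex.ofReal_im]
  rw [herglotzKernel, Complex.sub_im, h2, one_div, Complex.inv_im, poissonKernel,
    Complex.normSq_apply]
  simp [pow_two]

theorem integrable_herglotzKernel_mul {μ : Measure ℝ}
    (hμ : Integrable (fun t : ℝ => 1 / (1 + t ^ 2)) μ) {k : ℝ → ℝ} (hk : Measurable k) {C : ℝ}
    (hC : ∀ t, |k t| ≤ C) {z : ℂ} (hz : 0 < z.im) :
    Integrable (fun t => herglotzKernel z t * (k t : ℂ)) μ := by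
  refine (hμ.const_mul (C * (z.im⁻¹ * (‖1 + z ^ 2‖ + ‖z‖ * z.im)))).mono'
    ((continuous_herglotzKernel hz).aestronglyMeasurable.mul
      (Complex.measurable_ofReal.comp hk).aestronglyMeasurable) (Eventually.of_forall fun t => ?_)
  have h := norm_im_mul_herglotzKernel_le hz t
  rw [norm_mul, Complex.norm_real, Real.norm_of_nonneg hz.le] at h
  have h' : ‖herglotzKernel z t‖ ≤ z.im⁻¹ * (‖1 + z ^ 2‖ + ‖z‖ * z.im) * (1 / (1 + t ^ 2)) := by
    rw [mul_assoc, ← div_eq_inv_mul, le_div_iff₀ hz, mul_comm]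
    exact h
  rw [norm_mul, Complex.norm_real, Real.norm_eq_abs]
  have hC0 : 0 ≤ C := (abs_nonneg _).trans (hC t)
  calc ‖herglotzKernel z t‖ * |k t|
      ≤ z.im⁻¹ * (‖1 + z ^ 2‖ + ‖z‖ * z.im) * (1 / (1 + t ^ 2)) * C :=
        mul_le_mul h' (hC t) (abs_nonneg _) ((norm_nonneg _).trans h')
    _ = _ := by ring

/-- Point masses are recovered from the Herglotz representation by a radial limit. -/
theorem tendsto_mul_integral_herglotzKernel {μ : Measure ℝ} [IsLocallyFiniteMeasure μ]
    (hμ : Integrable (fun t : ℝ => 1 / (1 + t ^ 2)) μ) {k : ℝ → ℝ} (hk : Measurable k) {C : ℝ}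
    (hC : ∀ t, |k t| ≤ C) (A B : ℝ) (x : ℝ) :
    Tendsto (fun y : ℝ => -(Complex.I * y) * (A + B * (x + y * Complex.I) +
      ∫ t, herglotzKernel (x + y * Complex.I) t * (k t : ℂ) ∂μ)) (𝓝[>] 0)
      (𝓝 ((k x * μ.real {x} : ℝ) : ℂ)) := by
  have him : ∀ y : ℝ, (x + y * Complex.I : ℂ).im = y := fun y => by simp
  -- At `t = x` the factor `-iy` equals `t - z` and cancels the pole; at every other `t` it sends
  -- the integrand to `0`. The pointwise limit is therefore supported at `x`.
  have hmain : Tendsto (fun y : ℝ => ∫ t, -(Complex.I * y) *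
      (herglotzKernel (x + y * Complex.I) t * (k t : ℂ)) ∂μ) (𝓝[>] 0)
      (𝓝 (∫ t, Set.indicator {x} (fun t => (k t : ℂ)) t ∂μ)) := by
    refine tendsto_integral_filter_of_dominated_convergence
      (fun t => ((1 + (|x| + 1) ^ 2) + (|x| + 1) * 1) * (1 / (1 + t ^ 2)) * C) ?_ ?_
      ((hμ.const_mul _).mul_const _) ?_
    · filter_upwards [self_mem_nhdsWithin] with y hy
      exact (integrable_herglotzKernel_mul hμ hk hC (by simpa using hy)).aestronglyMeasurable.const_mul _
    · filter_upwards [Ioo_mem_nhdsGT one_pos] with y hy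
      refine Eventually.of_forall fun t => ?_
      have h := norm_im_mul_herglotzKernel_le (z := x + y * Complex.I) (by simpa using hy.1) t
      rw [him] at h
      have hz : ‖(x + y * Complex.I : ℂ)‖ ≤ |x| + 1 := by
        refine (norm_add_le _ _).trans ?_
        rw [norm_mul, Complex.norm_real, Complex.norm_real, Complex.norm_I, mul_one,
          Real.norm_eq_abs, Real.norm_of_nonneg hy.1.le]
        linarith [hy.2]
      have hz2 : ‖(1 + (x + y * Complex.I) ^ 2 : ℂ)‖ ≤ 1 + (|x| + 1) ^ 2 := by
        refine (norm_add_le _ _).trans ?_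
        rw [norm_one, norm_pow]
        gcongr
      have hC0 : 0 ≤ C := (abs_nonneg _).trans (hC t)
      rw [← mul_assoc, norm_mul, Complex.norm_real, Real.norm_eq_abs]
      have heq : ‖-(Complex.I * y) * herglotzKernel (x + y * Complex.I) t‖ =
          ‖(y : ℂ) * herglotzKernel (x + y * Complex.I) t‖ := by
        simp only [norm_mul, norm_neg, Complex.norm_I, one_mul]
      rw [heq]
      refine mul_le_mul (h.trans ?_) (hC t) (abs_nonneg _) (by positivity)
      have hy1 := hy.1.le
      have hy2 := hy.2.le
      gcongr
    · refine Eventually.of_forall fun t => ?_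
      by_cases ht : t = x
      · subst ht
        rw [Set.indicator_of_mem (Set.mem_singleton t)]
        have h1 : Tendsto (fun y : ℝ => (1 + Complex.I * y * (t / (1 + (t : ℂ) ^ 2))) * (k t : ℂ))
            (𝓝[>] 0) (𝓝 ((1 + Complex.I * (0 : ℝ) * (t / (1 + (t : ℂ) ^ 2))) * (k t : ℂ))) :=
          (Continuous.tendsto (by fun_prop) 0).mono_left nhdsWithin_le_nhds
        simp only [Complex.ofReal_zero, mul_zero, zero_mul, add_zero, one_mul] at h1
        refine h1.congr' ?_
        filter_upwards [self_mem_nhdsWithin] with y hy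
        have hy0 : (y : ℂ) ≠ 0 := by exact_mod_cast (ne_of_gt hy)
        have hI : (t : ℂ) - (t + y * Complex.I) = -(Complex.I * y) := by ring
        have hIy : -(Complex.I * (y : ℂ)) ≠ 0 := neg_ne_zero.2 (mul_ne_zero Complex.I_ne_zero hy0)
        rw [herglotzKernel, hI, ← mul_assoc, mul_sub, mul_one_div_cancel hIy]
        ring
      · rw [Set.indicator_of_notMem (Set.notMem_singleton_iff.2 ht)]
        have htx : (t : ℂ) - (x + (0 : ℝ) * Complex.I) ≠ 0 := by
          rw [Complex.ofReal_zero, zero_mul, add_zero, sub_ne_zero]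
          exact_mod_cast ht
        have h1 : ContinuousAt (fun y : ℝ => -(Complex.I * y) *
            ((1 / ((t : ℂ) - (x + y * Complex.I)) - t / (1 + (t : ℂ) ^ 2)) * (k t : ℂ))) 0 := by
          refine ContinuousAt.mul (by fun_prop) (ContinuousAt.mul (ContinuousAt.sub ?_ ?_) ?_)
          · exact continuousAt_const.div (by fun_prop) htx
          · exact continuousAt_const
          · exact continuousAt_const
        have h2 := h1.tendsto.mono_left (nhdsWithin_le_nhds (s := Set.Ioi 0))
        simp only [Complex.ofReal_zero, mul_zero, neg_zero, zero_mul] at h2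
        exact h2
  have hpoly : Tendsto (fun y : ℝ => -(Complex.I * y) * (A + B * (x + y * Complex.I)))
      (𝓝[>] 0) (𝓝 (-(Complex.I * (0 : ℝ)) * (A + B * (x + (0 : ℝ) * Complex.I)))) :=
    (Continuous.tendsto (by fun_prop) 0).mono_left nhdsWithin_le_nhds
  have hint : ∫ t, Set.indicator {x} (fun t => (k t : ℂ)) t ∂μ = ((k x * μ.real {x} : ℝ) : ℂ) := by
    rw [integral_indicator (measurableSet_singleton x), Measure.restrict_singleton,
      integral_smul_measure, integral_dirac]
    rw [measureReal_def, Complex.real_smul]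
    push_cast
    ring
  rw [hint] at hmain
  have := hpoly.add hmain
  simp only [Complex.ofReal_zero, mul_zero, neg_zero, zero_mul, zero_add] at this
  refine this.congr fun y => ?_
  rw [integral_const_mul]
  ring

/-! ### Scalar measures attached to a matrix measure -/

namespace MatrixMeasure

variable (ρ : MatrixMeasure)

theorem W_symm (t : ℝ) : ρ.W t 1 0 = ρ.W t 0 1 := by
  simpa using (ρ.posSemidef_W t).isHermitian.apply 0 1

theorem W_add (t : ℝ) : ρ.W t 0 0 + ρ.W t 1 1 = 1 := by
  rw [← Matrix.trace_fin_two, ρ.trace_W t]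

/-- Trace one and positivity put the diagonal entries in `[0, 1]`; the determinant then controls the
off-diagonal one. -/
theorem abs_W_le (t : ℝ) (i j : Fin 2) : |ρ.W t i j| ≤ 1 := by
  have h0 : 0 ≤ ρ.W t 0 0 := (ρ.posSemidef_W t).diag_nonneg
  have h1 : 0 ≤ ρ.W t 1 1 := (ρ.posSemidef_W t).diag_nonneg
  have h2 := ρ.W_add t
  have h3 : 0 ≤ (ρ.W t).det := (ρ.posSemidef_W t).det_nonneg
  rw [Matrix.det_fin_two, ρ.W_symm] at h3
  have h4 : |ρ.W t 0 1| ≤ 1 := by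
    rw [← sq_le_one_iff_abs_le_one]
    nlinarith
  fin_cases i <;> fin_cases j
  · exact abs_le.2 ⟨by simp; linarith, by simp; linarith⟩
  · exact h4
  · simp only [Fin.mk_one, Fin.zero_eta, ρ.W_symm]; exact h4
  · exact abs_le.2 ⟨by simp; linarith, by simp; linarith⟩

/-- The quadratic form of the matrix density. -/
def quad (v : Fin 2 → ℝ) (t : ℝ) : ℝ := v ⬝ᵥ (ρ.W t).mulVec v

theorem quad_nonneg (v : Fin 2 → ℝ) (t : ℝ) : 0 ≤ ρ.quad v t := by
  simpa [quad] using (ρ.posSemidef_W t).dotProduct_mulVec_nonneg v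

theorem quad_eq (v : Fin 2 → ℝ) (t : ℝ) : ρ.quad v t = ∑ i, ∑ j, v i * v j * ρ.W t i j := by
  simp [quad, dotProduct, Matrix.mulVec, Fin.sum_univ_two]
  ring

theorem measurable_quad (v : Fin 2 → ℝ) : Measurable (ρ.quad v) := by
  have : ρ.quad v = fun t => ∑ i, ∑ j, v i * v j * ρ.W t i j := funext (ρ.quad_eq v)
  rw [this]
  exact Finset.measurable_sum _ fun i _ => Finset.measurable_sum _ fun j _ =>
    (ρ.measurable_W i j).const_mul _

theorem quad_le (v : Fin 2 → ℝ) (t : ℝ) : ρ.quad v t ≤ ∑ i, ∑ j, |v i * v j| := by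
  rw [quad_eq]
  refine Finset.sum_le_sum fun i _ => Finset.sum_le_sum fun j _ => ?_
  refine (le_abs_self _).trans ?_
  rw [abs_mul]
  exact mul_le_of_le_one_right (abs_nonneg _) (ρ.abs_W_le t i j)

/-- The scalar measure `v* dρ v`. -/
noncomputable def scalar (v : Fin 2 → ℝ) : Measure ℝ :=
  ρ.μ.withDensity fun t => ENNReal.ofReal (ρ.quad v t)

theorem scalar_le (v : Fin 2 → ℝ) :
    ρ.scalar v ≤ ENNReal.ofReal (∑ i, ∑ j, |v i * v j|) • ρ.μ := by
  rw [scalar, ← withDensity_const]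
  exact withDensity_mono (Eventually.of_forall fun t => ENNReal.ofReal_le_ofReal (ρ.quad_le v t))

instance : IsLocallyFiniteMeasure ρ.μ := ρ.locallyFinite

instance (v : Fin 2 → ℝ) : IsLocallyFiniteMeasure (ρ.scalar v) := by
  refine ⟨fun x => ?_⟩
  obtain ⟨s, hs, hfin⟩ := ρ.μ.finiteAt_nhds x
  refine ⟨s, hs, (ρ.scalar_le v s).trans_lt ?_⟩
  rw [Measure.smul_apply, smul_eq_mul]
  exact ENNReal.mul_lt_top ENNReal.ofReal_lt_top hfin

theorem integrable_scalar {f : ℝ → ℝ} (hf : Integrable f ρ.μ) (v : Fin 2 → ℝ) :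
    Integrable f (ρ.scalar v) :=
  (hf.smul_measure ENNReal.ofReal_ne_top).mono_measure (ρ.scalar_le v)

theorem integral_scalar (v : Fin 2 → ℝ) (f : ℝ → ℝ) :
    ∫ t, f t ∂(ρ.scalar v) = ∫ t, f t * ρ.quad v t ∂ρ.μ := by
  rw [scalar, integral_withDensity_eq_integral_toReal_smul (ρ.measurable_quad v).ennreal_ofReal
    (Eventually.of_forall fun _ => ENNReal.ofReal_lt_top)]
  refine integral_congr_ae (Eventually.of_forall fun t => ?_)
  simp only [smul_eq_mul]
  rw [ENNReal.toReal_ofReal (ρ.quad_nonneg v t), mul_comm]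

/-- By the trace normalization, null sets and absolute continuity can be checked on the scalar
measures and transferred to `μ`. -/
theorem scalar_add_scalar : ρ.scalar ![1, 0] + ρ.scalar ![0, 1] = ρ.μ := by
  rw [scalar, scalar, ← withDensity_add_left (ρ.measurable_quad _).ennreal_ofReal]
  conv_rhs => rw [← withDensity_one (μ := ρ.μ)]
  congr 1
  funext t
  rw [Pi.add_apply, ← ENNReal.ofReal_add (ρ.quad_nonneg _ _) (ρ.quad_nonneg _ _), Pi.one_apply]
  simp [quad_eq, Fin.sum_univ_two, ρ.W_add]

end MatrixMeasure

/-! ### From boundary values of `M` to the density of the spectral measure -/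

namespace MatrixMeasure

variable {ρ : MatrixMeasure} {M : ℂ → Matrix (Fin 2) (Fin 2) ℂ} {A B : Matrix (Fin 2) (Fin 2) ℝ}

/-- The imaginary part of a quadratic form of a matrix valued Herglotz function is the Poisson
integral of a scalar measure. -/
theorem im_quadForm_eq (hμ : Integrable (fun t : ℝ => 1 / (1 + t ^ 2)) ρ.μ)
    (hM : ∀ z : ℂ, 0 < z.im → ∀ i j, M z i j =
      A i j + B i j * z + ∫ t, herglotzKernel z t * (ρ.W t i j : ℂ) ∂ρ.μ)
    (v : Fin 2 → ℝ) {z : ℂ} (hz : 0 < z.im) :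
    ∑ i, ∑ j, v i * v j * (M z i j).im =
      (∑ i, ∑ j, v i * v j * B i j) * z.im +
        ∫ t, poissonKernel z.im z.re t ∂(ρ.scalar v) := by
  have hint : ∀ i j, Integrable (fun t => herglotzKernel z t * (ρ.W t i j : ℂ)) ρ.μ := fun i j =>
    integrable_herglotzKernel_mul hμ (ρ.measurable_W i j) (fun t => ρ.abs_W_le t i j) hz
  have him : ∀ i j t, (herglotzKernel z t * (ρ.W t i j : ℂ)).im =
      poissonKernel z.im z.re t * ρ.W t i j := fun i j t => by
    rw [Complex.im_mul_ofReal, im_herglotzKernel]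
  have hint' : ∀ i j, Integrable (fun t => poissonKernel z.im z.re t * ρ.W t i j) ρ.μ :=
    fun i j => (hint i j).im.congr (Eventually.of_forall (him i j))
  have hMim : ∀ i j, (M z i j).im =
      B i j * z.im + ∫ t, poissonKernel z.im z.re t * ρ.W t i j ∂ρ.μ := fun i j => by
    rw [hM z hz, Complex.add_im, Complex.add_im, Complex.ofReal_im, Complex.im_ofReal_mul, zero_add]
    congr 1
    simp_rw [← him]
    exact (integral_im (hint i j)).symm
  have hquad : ∀ t, poissonKernel z.im z.re t * ρ.quad v t =
      ∑ i, ∑ j, v i * v j * (poissonKernel z.im z.re t * ρ.W t i j) := fun t => by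
    rw [quad_eq, Finset.mul_sum]
    refine Finset.sum_congr rfl fun i _ => ?_
    rw [Finset.mul_sum]
    exact Finset.sum_congr rfl fun j _ => by ring
  rw [integral_scalar]
  simp_rw [hquad]
  rw [integral_finsetSum _ fun i _ => integrable_finsetSum _ fun j _ => (hint' i j).const_mul _]
  simp_rw [integral_finsetSum _ fun j _ => (hint' _ j).const_mul _, integral_const_mul, hMim]
  simp only [Fin.sum_univ_two]
  ring

section BoundaryValues

variable {U : Set ℝ} {L : ℝ → Matrix (Fin 2) (Fin 2) ℂ}

/-- Testing against a fixed real vector reduces matrix inversion to the scalar Stieltjes formula.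
The density is nonnegative as a limit of Poisson integrals plus a nonnegative linear term. -/
theorem scalar_restrict_eq (hμ : Integrable (fun t : ℝ => 1 / (1 + t ^ 2)) ρ.μ)
    (hB : B.PosSemidef)
    (hM : ∀ z : ℂ, 0 < z.im → ∀ i j, M z i j =
      A i j + B i j * z + ∫ t, herglotzKernel z t * (ρ.W t i j : ℂ) ∂ρ.μ)
    (hU : IsOpen U)
    (hL : ∀ x ∈ U, ∀ i j, Tendsto (fun z => M z i j) (𝓝[upperHalf] (x : ℂ)) (𝓝 (L x i j)))
    (v : Fin 2 → ℝ) :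
    ContinuousOn (fun x => ∑ i, ∑ j, v i * v j * (L x i j).im) U ∧
    (∀ x ∈ U, 0 ≤ ∑ i, ∑ j, v i * v j * (L x i j).im) ∧
    (ρ.scalar v).restrict U = (volume.withDensity fun x =>
      ENNReal.ofReal ((∑ i, ∑ j, v i * v j * (L x i j).im) / Real.pi)).restrict U := by
  have hlim : ∀ x ∈ U, Tendsto (fun z => ∑ i, ∑ j, v i * v j * (M z i j).im)
      (𝓝[{z | 0 < z.im}] (x : ℂ)) (𝓝 (∑ i, ∑ j, v i * v j * (L x i j).im)) := fun x hx =>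
    tendsto_finsetSum _ fun i _ => tendsto_finsetSum _ fun j _ =>
      ((Complex.continuous_im.tendsto _).comp (hL x hx i j)).const_mul _
  have hβ : 0 ≤ ∑ i, ∑ j, v i * v j * B i j := by
    have h := hB.dotProduct_mulVec_nonneg v
    rw [star_trivial] at h
    refine h.trans_eq ?_
    simp [dotProduct, Matrix.mulVec, Fin.sum_univ_two]
    ring
  have hw : ∀ x ∈ U, 0 ≤ ∑ i, ∑ j, v i * v j * (L x i j).im := fun x hx => by
    have hvert := (hlim x hx).comp (tendsto_vertical x)
    refine ge_of_tendsto hvert ?_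
    filter_upwards [self_mem_nhdsWithin] with y hy
    have hy' : 0 < (x + y * Complex.I : ℂ).im := by simpa using hy
    rw [Function.comp_apply, im_quadForm_eq hμ hM v hy']
    exact add_nonneg (mul_nonneg hβ hy'.le) (integral_nonneg fun t => poissonKernel_nonneg hy' _ _)
  exact ⟨continuousOn_boundaryValue hlim, hw,
    restrict_eq_withDensity_boundaryValue (ρ.integrable_scalar hμ v)
      (fun z hz => im_quadForm_eq hμ hM v hz) hU hlim hw⟩

theorem restrict_absolutelyContinuous (hμ : Integrable (fun t : ℝ => 1 / (1 + t ^ 2)) ρ.μ)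
    (hB : B.PosSemidef)
    (hM : ∀ z : ℂ, 0 < z.im → ∀ i j, M z i j =
      A i j + B i j * z + ∫ t, herglotzKernel z t * (ρ.W t i j : ℂ) ∂ρ.μ)
    (hU : IsOpen U)
    (hL : ∀ x ∈ U, ∀ i j, Tendsto (fun z => M z i j) (𝓝[upperHalf] (x : ℂ)) (𝓝 (L x i j))) :
    ρ.μ.restrict U ≪ volume := by
  have h : ∀ v, (ρ.scalar v).restrict U ≪ volume := fun v => by
    rw [(scalar_restrict_eq hμ hB hM hU hL v).2.2]
    exact Measure.restrict_le_self.absolutelyContinuous.trans (withDensity_absolutelyContinuous _ _)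
  rw [← ρ.scalar_add_scalar, Measure.restrict_add]
  exact Measure.AbsolutelyContinuous.add_left (h _) (h _)

/-- Where a set has full measure and `M` has boundary values on it, the density of the absolutely
continuous part of its spectral measure is `π⁻¹ Im M(x)`. -/
theorem ae_acDensity_eq (hμ : Integrable (fun t : ℝ => 1 / (1 + t ^ 2)) ρ.μ)
    (hB : B.PosSemidef)
    (hM : ∀ z : ℂ, 0 < z.im → ∀ i j, M z i j =
      A i j + B i j * z + ∫ t, herglotzKernel z t * (ρ.W t i j : ℂ) ∂ρ.μ)
    (hU : IsOpen U) (hU0 : volume Uᶜ = 0)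
    (hL : ∀ x ∈ U, ∀ i j, Tendsto (fun z => M z i j) (𝓝[upperHalf] (x : ℂ)) (𝓝 (L x i j)))
    (hsymm : ∀ x ∈ U, L x 1 0 = L x 0 1) :
    ∀ᵐ x : ℝ, x ∈ U → ∀ i j, ρ.acDensity x i j = (L x i j).im / Real.pi := by
  have hUae : ∀ᵐ x : ℝ, x ∈ U := by
    simpa using measure_eq_zero_iff_ae_notMem.1 hU0
  have hvol : (volume : Measure ℝ).restrict U = volume := Measure.restrict_eq_self_of_ae_mem hUae
  have hac := restrict_absolutelyContinuous hμ hB hM hU hL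
  -- On the conull set `U` the measure is absolutely continuous, so `rnDeriv` of all of `μ` already
  -- is its density there.
  have hμU : ρ.μ.restrict U = volume.withDensity (ρ.μ.rnDeriv volume) := by
    rw [← Measure.withDensity_rnDeriv_eq _ _ hac]
    refine withDensity_congr_ae ?_
    filter_upwards [Measure.rnDeriv_restrict ρ.μ volume hU.measurableSet, hUae] with x hx hxU
    rw [hx, Set.indicator_of_mem hxU]
  have hv : ∀ v : Fin 2 → ℝ, ∀ᵐ x : ℝ, x ∈ U → (ρ.μ.rnDeriv volume x).toReal * ρ.quad v x =
      (∑ i, ∑ j, v i * v j * (L x i j).im) / Real.pi := fun v => by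
    obtain ⟨hcont, hw, heq⟩ := scalar_restrict_eq hμ hB hM hU hL v
    have hquad := (ρ.measurable_quad v).ennreal_ofReal
    have haem : AEMeasurable (fun x =>
        ENNReal.ofReal ((∑ i, ∑ j, v i * v j * (L x i j).im) / Real.pi)) volume := by
      rw [← hvol]
      exact ((hcont.aemeasurable hU.measurableSet).div_const _).ennreal_ofReal
    rw [restrict_withDensity hU.measurableSet, hvol, scalar, restrict_withDensity hU.measurableSet,
      hμU, ← withDensity_mul _ (Measure.measurable_rnDeriv _ _) hquad,
      withDensity_eq_iff_of_sigmaFinite ((Measure.measurable_rnDeriv _ _).mul hquad).aemeasurable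
        haem] at heq
    filter_upwards [heq] with x hx hxU
    have h1 := congrArg ENNReal.toReal hx
    rwa [Pi.mul_apply, ENNReal.toReal_mul, ENNReal.toReal_ofReal (ρ.quad_nonneg v x),
      ENNReal.toReal_ofReal (div_nonneg (hw x hxU) Real.pi_pos.le)] at h1
  -- Polarization: these three vectors determine a symmetric `2 × 2` matrix.
  filter_upwards [hv ![1, 0], hv ![0, 1], hv ![1, 1]] with x h0 h1 h2 hxU
  have h0 := h0 hxU
  have h1 := h1 hxU
  have h2 := h2 hxU
  simp only [quad_eq, Fin.sum_univ_two, Matrix.cons_val_zero, Matrix.cons_val_one, ρ.W_symm,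
    hsymm x hxU, mul_one, one_mul, mul_zero, zero_mul, add_zero, zero_add] at h0 h1 h2
  have h01 : (ρ.μ.rnDeriv volume x).toReal * ρ.W x 0 1 = (L x 0 1).im / Real.pi := by
    field_simp at h0 h1 h2 ⊢
    linarith
  intro i j
  rw [acDensity, Matrix.smul_apply, smul_eq_mul]
  fin_cases i <;> fin_cases j
  · exact h0
  · exact h01
  · change _ * ρ.W x 1 0 = (L x 1 0).im / _
    rw [ρ.W_symm, hsymm x hxU]
    exact h01
  · exact h1

end BoundaryValues

end MatrixMeasure

/-! ### The multiplication operator in `L²(ℝ, dρ)` -/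

namespace MatrixMeasure

variable (ρ : MatrixMeasure)

/-- The density of `ρ_f` with respect to the trace measure. -/
noncomputable def specDensity (f : ℝ → Fin 2 → ℂ) (t : ℝ) : ENNReal :=
  ENNReal.ofReal (star (f t) ⬝ᵥ ((ρ.W t).map Complex.ofReal).mulVec (f t)).re

theorem spec_univ (f : ℝ → Fin 2 → ℂ) : ρ.spec f Set.univ = ∫⁻ t, ρ.specDensity f t ∂ρ.μ := by
  rw [spec, withDensity_apply _ MeasurableSet.univ, Measure.restrict_univ]
  rfl

theorem measurable_specDensity {f : ℝ → Fin 2 → ℂ} (hf : Measurable f) :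
    Measurable (ρ.specDensity f) := by
  have hfi : ∀ i, Measurable fun t => f t i := fun i => (measurable_pi_apply i).comp hf
  have hW : ∀ i j, Measurable fun t => (ρ.W t i j : ℂ) := fun i j =>
    Complex.measurable_ofReal.comp (ρ.measurable_W i j)
  refine (Complex.measurable_re.comp ?_).ennreal_ofReal
  simp only [dotProduct, Matrix.mulVec, Matrix.map_apply, Pi.star_apply]
  exact Finset.measurable_sum _ fun i _ =>
    (continuous_star.measurable.comp (hfi i)).mul (Finset.measurable_sum _ fun j _ => (hW i j).mul (hfi j))

theorem specDensity_smul (c : ℝ → ℂ) (f : ℝ → Fin 2 → ℂ) (t : ℝ) :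
    ρ.specDensity (fun t => c t • f t) t =
      ENNReal.ofReal (‖c t‖ ^ 2) * ρ.specDensity f t := by
  rw [specDensity, specDensity, ← ENNReal.ofReal_mul (by positivity), star_smul, smul_dotProduct,
    Matrix.mulVec_smul, dotProduct_smul, smul_smul, smul_eq_mul, ← Complex.re_ofReal_mul]
  congr 3
  rw [mul_comm, RCLike.star_def, Complex.mul_conj']
  push_cast
  rfl

theorem specDensity_eq_zero {f : ℝ → Fin 2 → ℂ} {t : ℝ} (h : f t = 0) :
    ρ.specDensity f t = 0 := by
  simp [specDensity, h]

variable {ρ}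

theorem isNull_iff {f : ℝ → Fin 2 → ℂ} (hf : Measurable f) :
    ρ.IsNull f ↔ ∀ᵐ t ∂ρ.μ, ρ.specDensity f t = 0 := by
  rw [IsNull, spec_univ, lintegral_eq_zero_iff (ρ.measurable_specDensity hf)]
  rfl

theorem measurable_mulSub {f : ℝ → Fin 2 → ℂ} (hf : Measurable f) (z : ℂ) :
    Measurable (mulSub z f) :=
  (Complex.measurable_ofReal.sub_const z).smul hf

theorem MemL2.smul {g : ℝ → Fin 2 → ℂ} (hg : ρ.MemL2 g) {c : ℝ → ℂ} (hc : Measurable c) {K : ℝ}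
    (hK : ∀ t, ‖c t‖ ≤ K) : ρ.MemL2 fun t => c t • g t := by
  refine ⟨hc.smul hg.1, ?_⟩
  have h := hg.2
  rw [spec_univ] at h ⊢
  calc ∫⁻ t, ρ.specDensity (fun t => c t • g t) t ∂ρ.μ
      ≤ ∫⁻ t, ENNReal.ofReal (K ^ 2) * ρ.specDensity g t ∂ρ.μ := by
        refine lintegral_mono fun t => ?_
        rw [specDensity_smul]
        gcongr
        exact hK t
    _ = ENNReal.ofReal (K ^ 2) * ∫⁻ t, ρ.specDensity g t ∂ρ.μ :=
        lintegral_const_mul _ (ρ.measurable_specDensity hg.1)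
    _ < ⊤ := ENNReal.mul_lt_top ENNReal.ofReal_lt_top h

/-- If multiplication by `t - z` annihilates `f`, then `f` vanishes away from `z`. -/
theorem isNull_of_isNull_mulSub {f : ℝ → Fin 2 → ℂ} (hf : Measurable f) {z : ℂ}
    (hz : ∀ᵐ t : ℝ ∂ρ.μ, (t : ℂ) ≠ z) (h : ρ.IsNull (mulSub z f)) : ρ.IsNull f := by
  rw [isNull_iff (measurable_mulSub hf z)] at h
  rw [isNull_iff hf]
  filter_upwards [h, hz] with t ht htz
  have h1 := ρ.specDensity_smul (fun t : ℝ => (t : ℂ) - z) f t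
  rw [show ρ.specDensity (fun t : ℝ => ((t : ℂ) - z) • f t) t = 0 from ht] at h1
  refine (mul_eq_zero.1 h1.symm).resolve_left ?_
  have : 0 < ‖(t : ℂ) - z‖ := norm_pos_iff.2 (sub_ne_zero.2 htz)
  rw [ENNReal.ofReal_eq_zero, not_le]
  positivity

/-- For `z` at positive distance from `E`, the inverse of `X - z` is multiplication by `(t - z)⁻¹`.
It maps into the domain because `t (t - z)⁻¹ = 1 + z (t - z)⁻¹` is bounded on `E`. -/
theorem spectrum_subset_of_isClosed {E : Set ℝ} (hE : IsClosed E) (h0 : ρ.μ Eᶜ = 0) :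
    ρ.spectrum ⊆ Complex.ofReal '' E := by
  intro z hz
  by_contra hzE
  refine hz ?_
  have hEae : ∀ᵐ t ∂ρ.μ, t ∈ E := by simpa using measure_eq_zero_iff_ae_notMem.1 h0
  obtain ⟨δ, hδ, hball⟩ := Metric.isOpen_iff.1
    (Complex.isometry_ofReal.isClosedEmbedding.isClosedMap E hE).isOpen_compl z hzE
  have hdist : ∀ t ∈ E, δ ≤ ‖(t : ℂ) - z‖ := fun t ht => by
    by_contra hlt
    refine hball (show (t : ℂ) ∈ Metric.ball z δ from ?_) ⟨t, ht, rfl⟩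
    rw [mem_ball_iff_norm]
    exact not_le.1 hlt
  refine ⟨fun f hf _ hnull => isNull_of_isNull_mulSub hf.1 ?_ hnull, fun g hg => ?_⟩
  · filter_upwards [hEae] with t ht h
    exact hzE ⟨t, ht, h⟩
  -- The multiplier is cut off outside the `μ`-conull set `E` so that it is bounded everywhere.
  · set c : ℝ → ℂ := E.indicator fun t => ((t : ℂ) - z)⁻¹ with hc
    have hcm : Measurable c :=
      ((Complex.measurable_ofReal.sub_const z).inv).indicator hE.measurableSet
    have hcE : ∀ t ∈ E, c t = ((t : ℂ) - z)⁻¹ := fun t ht => Set.indicator_of_mem ht _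
    have hcb : ∀ t, ‖c t‖ ≤ δ⁻¹ := fun t => by
      by_cases ht : t ∈ E
      · rw [hcE t ht, norm_inv]
        exact inv_anti₀ hδ (hdist t ht)
      · rw [hc, Set.indicator_of_notMem ht, norm_zero]
        positivity
    have hcE1 : ∀ t ∈ E, ((t : ℂ) - z) * c t = 1 := fun t ht => by
      rw [hcE t ht]
      exact mul_inv_cancel₀ (norm_pos_iff.1 (hδ.trans_le (hdist t ht)))
    have htc : ∀ t : ℝ, ‖((t : ℂ) - 0) * c t‖ ≤ 1 + ‖z‖ * δ⁻¹ := fun t => by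
      by_cases ht : t ∈ E
      · rw [show ((t : ℂ) - 0) * c t = 1 + z * c t by linear_combination hcE1 t ht]
        refine (norm_add_le _ _).trans ?_
        rw [norm_one, norm_mul]
        gcongr
        exact hcb t
      · rw [hc, Set.indicator_of_notMem ht, mul_zero, norm_zero]
        positivity
    have hf := hg.smul hcm hcb
    have hmul : ∀ w : ℂ, mulSub w (fun t => c t • g t) = fun t : ℝ => (((t : ℂ) - w) * c t) • g t :=
      fun w => funext fun t => smul_smul _ _ _
    refine ⟨fun t => c t • g t, hf, ?_, ?_⟩
    · rw [hmul]
      exact hg.smul ((Complex.measurable_ofReal.sub_const 0).mul hcm) htc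
    · rw [isNull_iff ((measurable_mulSub hf.1 z).sub hg.1)]
      filter_upwards [hEae] with t ht
      refine ρ.specDensity_eq_zero ?_
      rw [hmul, Pi.sub_apply, hcE1 t ht, one_smul, sub_self]

/-- An eigenfunction vanishes off `t = z`, so it can be nonzero only if `z` is real and carries an
atom. -/
theorem IsEigenvalue.exists_measure_singleton_ne_zero {z : ℂ} (h : ρ.IsEigenvalue z) :
    ∃ x : ℝ, ρ.μ {x} ≠ 0 ∧ (x : ℂ) = z := by
  obtain ⟨f, hf, -, hne, hnull⟩ := h
  by_contra hcon
  push Not at hcon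
  refine hne (isNull_of_isNull_mulSub hf.1 ?_ hnull)
  by_cases h0 : ρ.μ {z.re} = 0
  · filter_upwards [measure_eq_zero_iff_ae_notMem.1 h0] with t ht htz
    exact ht (by rw [← htz]; simp)
  · refine Eventually.of_forall fun t htz => ?_
    refine hcon z.re h0 ?_
    rw [← htz, Complex.ofReal_re]

/-- On `U` the measure `ρ_f` is both singular and absolutely continuous, hence zero; on the
countable complement it has no mass because it has no atoms. -/
theorem noSingularContinuousSpectrum_of_restrict {U : Set ℝ} (hU : Uᶜ.Countable)
    (hac : ρ.μ.restrict U ≪ volume) : ρ.NoSingularContinuousSpectrum := by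
  intro f _ hsing hatom
  have hspec : (ρ.spec f).restrict U ≪ volume :=
    ((withDensity_absolutelyContinuous _ _).restrict U).trans hac
  obtain ⟨S, hS, hS0, hS1⟩ := hsing
  have h1 : ρ.spec f (Sᶜ ∩ U) = 0 := by
    rw [← Measure.restrict_apply hS.compl]
    exact hspec hS1
  have h2 : ρ.spec f Uᶜ = 0 := by
    rw [← Set.biUnion_of_singleton Uᶜ]
    exact (measure_biUnion_null_iff hU).2 fun x _ => hatom x
  refine measure_mono_null (fun t _ => ?_) (measure_union_null (measure_union_null hS0 h1) h2)
  by_cases htU : t ∈ U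
  · by_cases htS : t ∈ S
    · exact Or.inl (Or.inl htS)
    · exact Or.inl (Or.inr ⟨htS, htU⟩)
  · exact Or.inr htU

end MatrixMeasure

/-! ### Spectral properties from `M = N / s` -/

section Spectral

variable {T : ℂ → Matrix.SpecialLinearGroup (Fin 2) ℂ} {ρ : MatrixMeasure}
  {M : ℂ → Matrix (Fin 2) (Fin 2) ℂ} {A B : Matrix (Fin 2) (Fin 2) ℝ} {s : ℂ → ℂ}

theorem tendsto_vertical_punctured (x : ℝ) :
    Tendsto (fun y : ℝ => (x + y * Complex.I : ℂ)) (𝓝[>] 0) (𝓝[≠] (x : ℂ)) :=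
  (tendsto_vertical x).mono_right (nhdsWithin_mono _ fun z hz h => by
    rw [Set.mem_singleton_iff.1 h] at hz
    simp at hz)

/-- The spectral measure has no point mass at an accumulation point of the bands. -/
theorem measure_singleton_eq_zero_of_accPt (hT : IsEntireSL T) (hne : ∃ z, disc T z ≠ 0)
    (hsq : ∀ z : ℂ, 0 < z.im → s z ^ 2 = disc T z)
    (hMs : ∀ z : ℂ, 0 < z.im → ∀ i j, M z i j * s z = fixMatrix T z i j)
    (hμ : Integrable (fun t : ℝ => 1 / (1 + t ^ 2)) ρ.μ)
    (hM : ∀ z : ℂ, 0 < z.im → ∀ i j, M z i j =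
      A i j + B i j * z + ∫ t, herglotzKernel z t * (ρ.W t i j : ℂ) ∂ρ.μ)
    {x : ℝ} (hx : AccPt x (𝓟 (bandSet T))) : ρ.μ {x} = 0 := by
  have hvert := tendsto_vertical_punctured x
  have hdisc : ∀ᶠ z in 𝓝[≠] (x : ℂ), disc T z ≠ 0 := by
    have hA : AnalyticOnNhd ℂ (disc T) Set.univ :=
      (differentiable_disc hT).differentiableOn.analyticOnNhd isOpen_univ
    refine Filter.not_frequently.1 fun h => ?_
    obtain ⟨z, hz⟩ := hne
    exact hz (hA.eqOn_zero_of_preconnected_of_frequently_eq_zero isPreconnected_univ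
      (Set.mem_univ (x : ℂ)) h (Set.mem_univ z))
  have hzero : ∀ i, ρ.W x i i * ρ.μ.real {x} = 0 := fun i => by
    set p : ℝ := ρ.W x i i * ρ.μ.real {x} with hp
    have h1 : Tendsto (fun y : ℝ => -(Complex.I * y) * M (x + y * Complex.I) i i) (𝓝[>] 0)
        (𝓝 (p : ℂ)) := by
      refine (tendsto_mul_integral_herglotzKernel hμ (ρ.measurable_W i i)
        (fun t => ρ.abs_W_le t i i) (A i i) (B i i) x).congr' ?_
      filter_upwards [self_mem_nhdsWithin] with y hy
      rw [hM (x + y * Complex.I) (by simpa using hy)]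
    -- The square of `(z - x) N / s`; squaring replaces `s` by `D`, so `Q` is meromorphic at `x`
    -- although `M` need not be.
    set Q : ℂ → ℂ := fun z => (z - x) ^ 2 * fixMatrix T z i i ^ 2 / disc T z with hQ
    have h2 : Tendsto (fun y : ℝ => Q (x + y * Complex.I)) (𝓝[>] 0) (𝓝 ((p : ℂ) ^ 2)) := by
      refine (h1.pow 2).congr' ?_
      filter_upwards [hvert.eventually hdisc, self_mem_nhdsWithin] with y hd hy
      have hz : 0 < (x + y * Complex.I : ℂ).im := by simpa using hy
      simp only [hQ]
      rw [eq_div_iff hd, ← hsq _ hz, ← hMs _ hz]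
      ring
    have hQm : MeromorphicAt Q x := by
      have hN : AnalyticAt ℂ (fun z => fixMatrix T z i i) x :=
        (differentiable_fixMatrix hT i i).analyticAt x
      have hD : AnalyticAt ℂ (disc T) x := (differentiable_disc hT).analyticAt x
      have hx1 : AnalyticAt ℂ (fun z : ℂ => z - x) x := analyticAt_id.sub analyticAt_const
      exact ((hx1.pow 2).mul (hN.pow 2)).meromorphicAt.div hD.meromorphicAt
    -- A pole would contradict the finite vertical limit; hence the limit exists from every
    -- direction, in particular along the real line.
    have hord : 0 ≤ meromorphicOrderAt Q x := by
      by_contra hlt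
      have h3 := (tendsto_cobounded_of_meromorphicOrderAt_neg (not_le.1 hlt)).comp hvert
      exact not_tendsto_atTop_of_tendsto_nhds h2.norm (tendsto_norm_atTop_iff_cobounded.2 h3)
    obtain ⟨c, hc⟩ := tendsto_nhds_of_meromorphicOrderAt_nonneg hQm hord
    have hcp : c = (p : ℂ) ^ 2 := tendsto_nhds_unique (hc.comp hvert) h2
    have hreal : Tendsto (fun t : ℝ => (Q t).re) (𝓝[≠] x) (𝓝 (p ^ 2)) := by
      have h3 : Tendsto (Complex.ofReal) (𝓝[≠] x) (𝓝[≠] (x : ℂ)) :=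
        Complex.continuous_ofReal.continuousWithinAt.tendsto_nhdsWithin
          fun y hy => by simpa using hy
      have h4 := (Complex.continuous_re.tendsto c).comp (hc.comp h3)
      rw [hcp, ← Complex.ofReal_pow, Complex.ofReal_re] at h4
      exact h4
    have hnonpos : ∀ t ∈ bandSet T, (Q t).re ≤ 0 := fun t ht => by
      have hN : fixMatrix T t i i = ((fixMatrix T t i i).re : ℂ) :=
        Complex.ext rfl (by rw [fixMatrix_im hT, Complex.ofReal_im])
      have h5 : Q t = (((t - x) ^ 2 * (fixMatrix T t i i).re ^ 2 / (disc T t).re : ℝ) : ℂ) := by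
        simp only [hQ]
        rw [disc_ofReal hT, hN]
        push_cast
        rfl
      rw [h5, Complex.ofReal_re]
      exact div_nonpos_of_nonneg_of_nonpos (by positivity) ((mem_bandSet_iff hT).1 ht)
    have hp2 : p ^ 2 ≤ 0 :=
      le_of_tendsto_of_frequently hreal ((accPt_iff_frequently_nhdsNE.1 hx).mono hnonpos)
    exact pow_eq_zero_iff two_ne_zero |>.1 (le_antisymm hp2 (sq_nonneg p))
  -- The two diagonal masses add up to `μ {x}` because `W` has trace one.
  have hsum : ρ.μ.real {x} = 0 := by
    have := ρ.W_add x
    linear_combination (hzero 0) + (hzero 1) - ρ.μ.real {x} * this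
  exact (measureReal_eq_zero_iff isCompact_singleton.measure_lt_top.ne).1 hsum

theorem fixMatrix_div_im (hT : IsEntireSL T) (x : ℝ) (σ : ℂ) (i j : Fin 2) :
    (fixMatrix T x i j / σ).im = (fixMatrix T x i j).re * (σ⁻¹).im := by
  rw [div_eq_mul_inv, Complex.mul_im, fixMatrix_im hT, zero_mul, add_zero]

/-- All of it is read off from the boundary values `N / σ` on `U`, the complement of the zeros of
the discriminant, except for point masses at the zeros themselves. -/
theorem spectral_properties (hT : IsEntireSL T) (hne : ∃ z, disc T z ≠ 0)
    (hs : DifferentiableOn ℂ s upperHalf)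
    (hsq : ∀ z : ℂ, 0 < z.im → s z ^ 2 = disc T z)
    (hMs : ∀ z : ℂ, 0 < z.im → ∀ i j, M z i j * s z = fixMatrix T z i j)
    (hμ : Integrable (fun t : ℝ => 1 / (1 + t ^ 2)) ρ.μ) (hB : B.PosSemidef)
    (hM : ∀ z : ℂ, 0 < z.im → ∀ i j, M z i j =
      A i j + B i j * z + ∫ t, herglotzKernel z t * (ρ.W t i j : ℂ) ∂ρ.μ) :
    ρ.spectrum ⊆ Complex.ofReal '' bandSet T ∧ ρ.NoSingularContinuousSpectrum ∧
      ρ.ACSpectrumOn (bandSet T) 2 ∧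
      ∀ z : ℂ, ρ.IsEigenvalue z → ∃ x : ℝ, IsIsolatedPoint (bandSet T) x ∧ (x : ℂ) = z := by
  set U : Set ℝ := (discZeros T)ᶜ with hUdef
  have hU : IsOpen U := (isClosed_discZeros hT).isOpen_compl
  have hUc : Uᶜ.Countable := by
    rw [hUdef, compl_compl]
    exact countable_of_not_accPt (not_accPt_discZeros hT hne)
  have hsqrt : ∀ x ∈ U, ∃ σ : ℂ, σ ^ 2 = disc T x ∧ Tendsto s (𝓝[upperHalf] (x : ℂ)) (𝓝 σ) :=
    fun x hx => exists_tendsto_sqrt hs.continuousOn (differentiable_disc hT).continuous hsq hx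
  choose! σ hσ hσlim using hsqrt
  have hσ0 : ∀ x ∈ U, σ x ≠ 0 := fun x hx h0 => hx (by
    change disc T x = 0
    rw [← hσ x hx, h0]
    simp)
  set L : ℝ → Matrix (Fin 2) (Fin 2) ℂ := fun x => Matrix.of fun i j => fixMatrix T x i j / σ x
  have hLim : ∀ x i j, (L x i j).im = (fixMatrix T x i j).re * ((σ x)⁻¹).im := fun x i j =>
    fixMatrix_div_im hT x (σ x) i j
  have hL : ∀ x ∈ U, ∀ i j, Tendsto (fun z => M z i j) (𝓝[upperHalf] (x : ℂ)) (𝓝 (L x i j)) := by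
    intro x hx i j
    have hN : Tendsto (fun z => fixMatrix T z i j) (𝓝[upperHalf] (x : ℂ))
        (𝓝 (fixMatrix T x i j)) :=
      (differentiable_fixMatrix hT i j).continuous.continuousAt.mono_left nhdsWithin_le_nhds
    refine (hN.div (hσlim x hx) (hσ0 x hx)).congr' ?_
    filter_upwards [(hσlim x hx).eventually_ne (hσ0 x hx), self_mem_nhdsWithin] with z hz hzim
    rw [Pi.div_apply, div_eq_iff hz]
    exact (hMs z hzim i j).symm
  -- In a gap `σ` is real, so the boundary value of `M` has no imaginary part.
  have hσim : ∀ x ∉ bandSet T, ((σ x)⁻¹).im = 0 := fun x hx => by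
    have hpos : 0 < (disc T x).re := not_le.1 fun h => hx ((mem_bandSet_iff hT).2 h)
    have hxU : x ∈ U := fun h => by
      rw [show disc T x = 0 from h] at hpos
      simp at hpos
    rw [Complex.inv_im, im_eq_zero_of_sq_pos hpos (by rw [hσ x hxU, ← disc_ofReal hT]), neg_zero,
      zero_div]
  have hEU : (bandSet T)ᶜ ⊆ U := fun x hx h => hx ((mem_bandSet_iff hT).2 (by
    rw [show disc T x = 0 from h, Complex.zero_re]))
  have hE0 : ρ.μ (bandSet T)ᶜ = 0 := by
    have hv : ∀ v, ρ.scalar v (bandSet T)ᶜ = 0 := fun v => by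
      have hEm := (isClosed_bandSet hT).measurableSet.compl
      have heq := congrArg (fun ν : Measure ℝ => ν (bandSet T)ᶜ)
        (MatrixMeasure.scalar_restrict_eq hμ hB hM hU hL v).2.2
      simp only [Measure.restrict_apply hEm, Set.inter_eq_left.2 hEU] at heq
      rw [heq, withDensity_apply _ hEm]
      refine setLIntegral_eq_zero hEm fun x hx => ?_
      simp [hLim, hσim x hx]
    rw [← ρ.scalar_add_scalar, Measure.add_apply, hv, hv, add_zero]
  have hac := MatrixMeasure.restrict_absolutelyContinuous hμ hB hM hU hL
  refine ⟨MatrixMeasure.spectrum_subset_of_isClosed (isClosed_bandSet hT) hE0,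
    MatrixMeasure.noSingularContinuousSpectrum_of_restrict hUc hac, ?_, fun z hz => ?_⟩
  · have hae := MatrixMeasure.ae_acDensity_eq hμ hB hM hU (hUc.measure_zero _) hL fun x _ => by
      simp [L, fixMatrix]
    filter_upwards [hae, measure_eq_zero_iff_ae_notMem.1 (hUc.measure_zero volume)] with x hx hxU
    have hxU : x ∈ U := not_not.1 hxU
    have hx := hx hxU
    refine ⟨fun hxE => ?_, fun hxE => ?_⟩
    · have hneg := disc_re_neg hT hxE hxU
      have hσre := re_eq_zero_of_sq_neg hneg (by rw [hσ x hxU, ← disc_ofReal hT])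
      have hκ : ((σ x)⁻¹).im ≠ 0 := fun h0 => by
        refine hσ0 x hxU (inv_eq_zero.1 (Complex.ext ?_ h0))
        rw [Complex.inv_re, hσre, zero_div, Complex.zero_re]
      -- In a band `Im (N / σ) = Im (1/σ) · N`, so its determinant is `Im (1/σ)²` times `-D/4`,
      -- which is nonzero.
      have hdet : (fixMatrix T x 0 0).re * (fixMatrix T x 1 1).re -
          (fixMatrix T x 0 1).re * (fixMatrix T x 1 0).re = -(disc T x).re / 4 := by
        have h := congrArg Complex.re (det_fixMatrix T x)
        rw [Matrix.det_fin_two] at h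
        simpa [fixMatrix_im hT] using h
      have hunit : IsUnit (ρ.acDensity x).det := by
        rw [isUnit_iff_ne_zero, Matrix.det_fin_two]
        simp only [hx, hLim]
        have : (((σ x)⁻¹).im / Real.pi) ^ 2 * (-(disc T x).re / 4) ≠ 0 :=
          mul_ne_zero (pow_ne_zero 2 (div_ne_zero hκ Real.pi_ne_zero)) (by linarith)
        rw [← hdet] at this
        convert this using 1
        ring
      rw [Matrix.rank_of_isUnit _ ((Matrix.isUnit_iff_isUnit_det _).2 hunit), Fintype.card_fin]
    · ext i j
      rw [hx, hLim, hσim x hxE, mul_zero, zero_div, Matrix.zero_apply]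
  · obtain ⟨x, hx0, rfl⟩ := hz.exists_measure_singleton_ne_zero
    refine ⟨x, ⟨?_, fun hacc => hx0 ?_⟩, rfl⟩
    · by_contra hxE
      exact hx0 (measure_mono_null (Set.singleton_subset_iff.2 hxE) hE0)
    · exact measure_singleton_eq_zero_of_accPt hT hne hsq hMs hμ hM hacc

end Spectral

end TodaMap

theorem theorem1p3 (mp mm : ℂ → OnePoint ℂ)
    (hmp : TodaMap.IsHerglotz mp) (hmm : TodaMap.IsHerglotz mm)
    (hne : ∃ z : ℂ, 0 < z.im ∧ mp z ≠ TodaMap.neg (mm z))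
    (T : ℂ → Matrix.SpecialLinearGroup (Fin 2) ℂ) (hT : TodaMap.IsEntireSL T)
    (hT1 : ¬ ∀ z, T z = 1) (hT2 : ¬ ∀ z, T z = -1)
    (hfix : ∀ z : ℂ, 0 < z.im →
      mp z = (T z : Matrix.GeneralLinearGroup (Fin 2) ℂ) • mp z ∧
      TodaMap.neg (mm z) = (T z : Matrix.GeneralLinearGroup (Fin 2) ℂ) • TodaMap.neg (mm z)) :
    TodaMap.IsUnionOfIntervals (TodaMap.bandSet T) ∧
    TodaMap.Reflectionless mp mm (TodaMap.bandSet T) ∧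
    ∀ ρ : TodaMap.MatrixMeasure, TodaMap.IsSpectralMeasure mp mm ρ →
      ρ.spectrum ⊆ Complex.ofReal '' TodaMap.bandSet T ∧
      ρ.NoSingularContinuousSpectrum ∧
      ρ.ACSpectrumOn (TodaMap.bandSet T) 2 ∧
      ∀ z : ℂ, ρ.IsEigenvalue z →
        ∃ x : ℝ, TodaMap.IsIsolatedPoint (TodaMap.bandSet T) x ∧ (x : ℂ) = z := by
  obtain ⟨s, hs, hall⟩ := TodaMap.exists_sqrt_disc hmp hmm hne hT hfix
  -- A vanishing discriminant would give `s = 0`, hence `N = M s = 0` on the upper half plane, which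
  -- is the excluded case `T ≡ ±1`.
  have hdisc : ∃ z, TodaMap.disc T z ≠ 0 := by
    by_contra hcon
    push Not at hcon
    refine (TodaMap.eq_one_or_neg_one hT fun z hz => ?_).elim hT1 hT2
    have hs0 : s z = 0 := pow_eq_zero_iff two_ne_zero |>.1 ((hall z hz).1.trans (hcon z))
    ext i j
    rw [← (hall z hz).2.1 i j, hs0, mul_zero, Matrix.zero_apply]
  refine ⟨TodaMap.isUnionOfIntervals_bandSet hT hdisc,
    TodaMap.reflectionless_bandSet hT hdisc hs (fun z hz => (hall z hz).1)
      fun z hz => (hall z hz).2.2, ?_⟩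
  rintro ρ ⟨hμ, A, B, -, hB, hM⟩
  exact TodaMap.spectral_properties (M := fun z => TodaMap.matrixM (mp z) (mm z)) hT hdisc hs
    (fun z hz => (hall z hz).1) (fun z hz => (hall z hz).2.1) hμ hB hM
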